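/- **Proposition (analyticity of the composition operator).** Let $m,h,k\in\mathbb N$ with $h,k\ge 1$, let $\alpha\in\,]0,1]$ and $\rho>0$. Let $\Omega\subseteq\mathbb R^h$ and $\Omega'\subseteq\mathbb R^k$ be bounded, open and connected (non-empty), and let $\Omega'$ be of class $C^1$, i.e. near each boundary point $\Omega'$ is mapped onto an open piece of a half space, and $\partial\Omega'$ onto the corresponding piece of the bounding hyperplane, by a $C^1$ diffeomorphism between open subsets of $\mathbb R^k$. Let $C^0_{\omega,\rho}(\mathrm{cl}\,\Omega)$ be the Roumieu class of the functions $u\in C^\infty(\mathrm{cl}\,\Omega)$ such that $$\|u\|_{C^0_{\omega,\rho}(\mathrm{cl}\,\Omega)}=\sup_{\beta\in\mathbb N^h}\frac{\rho^{|\beta|}}{|\beta|!}\,\sup_{\mathrm{cl}\,\Omega}|D^\beta u|<+\infty ,$$ with this norm. Let $C^{m,\alpha}(\mathrm{cl}\,\Omega')$ be the Schauder space of the real-valued functions of class $C^m$ in $\Omega'$ that, together with their derivatives of order at most $m$, extend continuously to $\mathrm{cl}\,\Omega'$, and whose derivatives of order $m$ are Hölder continuous with exponent $\alpha$, with its usual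 norm $$\|f\|_{C^{m,\alpha}(\mathrm{cl}\,\Omega')}=\sum_{|\beta|\le m}\sup_{\mathrm{cl}\,\Omega'}|D^\beta f|+\sum_{|\beta|=m}\ \sup_{x\ne y}\frac{|D^\beta f(x)-D^\beta f(y)|}{|x-y|^\alpha}.$$ Let $C^{m,\alpha}(\mathrm{cl}\,\Omega',\mathbb R^h)=(C^{m,\alpha}(\mathrm{cl}\,\Omega'))^h$, with the product norm, and $C^{m,\alpha}(\mathrm{cl}\,\Omega',\Omega)=\{v\in C^{m,\alpha}(\mathrm{cl}\,\Omega',\mathbb R^h): v(\mathrm{cl}\,\Omega')\subseteq\Omega\}$. Then $C^0_{\omega,\rho}(\mathrm{cl}\,\Omega)\times C^{m,\alpha}(\mathrm{cl}\,\Omega',\Omega)$ is an open subset of $C^0_{\omega,\rho}(\mathrm{cl}\,\Omega)\times C^{m,\alpha}(\mathrm{cl}\,\Omega',\mathbb R^h)$; for all $(u,v)$ in it, $T[u,v]\equiv u\circ v$ belongs to $C^{m,\alpha}(\mathrm{cl}\,\Omega')$; and the operator $T$ is real analytic from this open subset to $C^{m,\alpha}(\mathrm{cl}\,\Omega')$.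 -/

import Mathlib

open scoped NNReal BoundedContinuousFunction
open TopologicalSpace (Opens)

noncomputable section

namespace SchauderRoumieu

variable {n : ℕ}

/-- The partial derivative `D^β F (x)`, for a multi-index `β`: the differential of `F` of order
`|β| = β₁ + ⋯ + βₙ` at `x`, evaluated at `β₁` copies of `e₁`, ..., `βₙ` copies of `eₙ`. -/
def partialD (β : Fin n → ℕ) (F : EuclideanSpace ℝ (Fin n) → ℝ)
    (x : EuclideanSpace ℝ (Fin n)) : ℝ :=
  iteratedFDeriv ℝ (∑ i, β i) F x
    fun j => EuclideanSpace.single (finSigmaFinEquiv.symm j).1 (1 : ℝ)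

/-- Extension by zero to the whole space of a function on the closure of `Ω` (only used to speak
of the derivatives at the points of the open set `Ω`, which do not see the extension). -/
def zeroExt {Ω : Opens (EuclideanSpace ℝ (Fin n))}
    (f : closure (Ω : Set (EuclideanSpace ℝ (Fin n))) → ℝ) : EuclideanSpace ℝ (Fin n) → ℝ :=
  Function.extend Subtype.val f 0

/-- `g`, a function on the closure of `Ω`, extends `D^β f`, a function on `Ω`. -/
def IsClosureDeriv {Ω : Opens (EuclideanSpace ℝ (Fin n))} (β : Fin n → ℕ)
    (f g : closure (Ω : Set (EuclideanSpace ℝ (Fin n))) →ᵇ ℝ) : Prop :=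
  ∀ x : closure (Ω : Set (EuclideanSpace ℝ (Fin n))),
    (x : EuclideanSpace ℝ (Fin n)) ∈ Ω → g x = partialD β (zeroExt f) x

/-- `D^β f` as a (bounded) continuous function on the closure of `Ω`, if there is such an
extension of `D^β f` (it is unique then); zero otherwise. -/
def closureDeriv {Ω : Opens (EuclideanSpace ℝ (Fin n))} (β : Fin n → ℕ)
    (f : closure (Ω : Set (EuclideanSpace ℝ (Fin n))) →ᵇ ℝ) :
    closure (Ω : Set (EuclideanSpace ℝ (Fin n))) →ᵇ ℝ := by
  classical exact if h : ∃ g, IsClosureDeriv β f g then h.choose else 0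

section basic

variable {Ω : Opens (EuclideanSpace ℝ (Fin n))}

lemma zeroExt_apply (f : closure (Ω : Set (EuclideanSpace ℝ (Fin n))) → ℝ)
    (x : closure (Ω : Set (EuclideanSpace ℝ (Fin n)))) : zeroExt f x = f x :=
  Subtype.val_injective.extend_apply f 0 x

lemma zeroExt_zero :
    zeroExt (0 : closure (Ω : Set (EuclideanSpace ℝ (Fin n))) → ℝ) = 0 := by
  exact Function.extend_zero _

lemma zeroExt_add (f g : closure (Ω : Set (EuclideanSpace ℝ (Fin n))) → ℝ) :
    zeroExt (f + g) = zeroExt f + zeroExt g := by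
  have h := Function.extend_add
    (Subtype.val : closure (Ω : Set (EuclideanSpace ℝ (Fin n))) → EuclideanSpace ℝ (Fin n))
    f g 0 0
  rw [add_zero] at h
  exact h

lemma zeroExt_smul (c : ℝ) (f : closure (Ω : Set (EuclideanSpace ℝ (Fin n))) → ℝ) :
    zeroExt (c • f) = c • zeroExt f := by
  have h := Function.extend_smul c
    (Subtype.val : closure (Ω : Set (EuclideanSpace ℝ (Fin n))) → EuclideanSpace ℝ (Fin n))
    f 0
  rw [smul_zero] at h
  exact h

lemma partialD_zero (F : EuclideanSpace ℝ (Fin n) → ℝ) (x : EuclideanSpace ℝ (Fin n)) :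
    partialD 0 F x = F x := by
  have key : ∀ (N : ℕ) (v : Fin N → EuclideanSpace ℝ (Fin n)), N = 0 →
      iteratedFDeriv ℝ N F x v = F x := by
    rintro N v rfl
    exact iteratedFDeriv_zero_apply v
  exact key _ _ (by simp)

lemma IsClosureDeriv.closureDeriv_eq {β : Fin n → ℕ}
    {f g : closure (Ω : Set (EuclideanSpace ℝ (Fin n))) →ᵇ ℝ} (h : IsClosureDeriv β f g) :
    closureDeriv β f = g := by
  have hex : ∃ g, IsClosureDeriv β f g := ⟨g, h⟩
  have h1 : IsClosureDeriv β f (closureDeriv β f) := by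
    rw [closureDeriv, dif_pos hex]
    exact hex.choose_spec
  have hd : Dense {x : closure (Ω : Set (EuclideanSpace ℝ (Fin n))) |
      (x : EuclideanSpace ℝ (Fin n)) ∈ Ω} := by
    intro x
    rw [closure_subtype]
    convert x.2 using 2
    ext y
    constructor
    · rintro ⟨z, hz, rfl⟩
      exact hz
    · intro hy
      exact ⟨⟨y, subset_closure hy⟩, hy, rfl⟩
  refine DFunLike.coe_injective (Continuous.ext_on hd (closureDeriv β f).continuous g.continuous ?_)
  intro x hx
  rw [h1 x hx, h x hx]

lemma isClosureDeriv_zero_index (f : closure (Ω : Set (EuclideanSpace ℝ (Fin n))) →ᵇ ℝ) :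
    IsClosureDeriv 0 f f := fun x _ => by
  rw [partialD_zero, zeroExt_apply]

lemma IsClosureDeriv.add {β : Fin n → ℕ}
    {f₁ f₂ g₁ g₂ : closure (Ω : Set (EuclideanSpace ℝ (Fin n))) →ᵇ ℝ}
    (hf₁ : ContDiffOn ℝ (∑ i, β i : ℕ) (zeroExt f₁) Ω)
    (hf₂ : ContDiffOn ℝ (∑ i, β i : ℕ) (zeroExt f₂) Ω)
    (h₁ : IsClosureDeriv β f₁ g₁) (h₂ : IsClosureDeriv β f₂ g₂) :
    IsClosureDeriv β (f₁ + f₂) (g₁ + g₂) := fun x hx => by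
  have hn := Ω.isOpen.mem_nhds hx
  have e : zeroExt (f₁ + f₂ : closure (Ω : Set (EuclideanSpace ℝ (Fin n))) →ᵇ ℝ) =
    zeroExt f₁ + zeroExt f₂ := zeroExt_add f₁ f₂
  rw [BoundedContinuousFunction.add_apply, h₁ x hx, h₂ x hx, e, partialD, partialD, partialD,
    iteratedFDeriv_add_apply (hf₁.contDiffAt hn) (hf₂.contDiffAt hn)]
  rfl

lemma IsClosureDeriv.smul {β : Fin n → ℕ} (c : ℝ)
    {f g : closure (Ω : Set (EuclideanSpace ℝ (Fin n))) →ᵇ ℝ}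
    (hf : ContDiffOn ℝ (∑ i, β i : ℕ) (zeroExt f) Ω)
    (h : IsClosureDeriv β f g) : IsClosureDeriv β (c • f) (c • g) := fun x hx => by
  have hn := Ω.isOpen.mem_nhds hx
  have e : zeroExt (c • f : closure (Ω : Set (EuclideanSpace ℝ (Fin n))) →ᵇ ℝ) =
    c • zeroExt f := zeroExt_smul c f
  rw [BoundedContinuousFunction.coe_smul]
  show c • g x = _
  rw [h x hx, e, partialD, partialD,
    iteratedFDeriv_const_smul_apply (hf.contDiffAt hn)]
  rfl

lemma isClosureDeriv_zero (β : Fin n → ℕ) :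
    IsClosureDeriv β (0 : closure (Ω : Set (EuclideanSpace ℝ (Fin n))) →ᵇ ℝ) 0 := fun x _ => by
  have e : zeroExt (0 : closure (Ω : Set (EuclideanSpace ℝ (Fin n))) →ᵇ ℝ) = 0 := zeroExt_zero
  rw [e, partialD, show (0 : EuclideanSpace ℝ (Fin n) → ℝ) = fun _ => (0 : ℝ) from rfl,
    iteratedFDeriv_fun_zero]
  rfl

end basic

/-- The space `C^m(cl Ω)`, for `m ∈ ℕ ∪ {∞}`: the functions that are of class `C^m` in `Ω` and
whose derivatives of (finite) order at most `m` extend continuously to the closure of `Ω`.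
Functions and extensions are asked to be bounded, which holds by itself if `Ω` is bounded. -/
def cmSubmodule (m : ℕ∞) (Ω : Opens (EuclideanSpace ℝ (Fin n))) :
    Submodule ℝ (closure (Ω : Set (EuclideanSpace ℝ (Fin n))) →ᵇ ℝ) where
  carrier := {f | ContDiffOn ℝ m (zeroExt f) Ω ∧
    ∀ β : Fin n → ℕ, ((∑ i, β i : ℕ) : ℕ∞) ≤ m → ∃ g, IsClosureDeriv β f g}
  zero_mem' := by
    refine ⟨?_, fun β _ => ⟨0, isClosureDeriv_zero β⟩⟩
    have e : zeroExt (0 : closure (Ω : Set (EuclideanSpace ℝ (Fin n))) →ᵇ ℝ) = 0 := zeroExt_zero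
    rw [e]
    exact contDiffOn_const
  add_mem' := by
    rintro f₁ f₂ ⟨h₁, d₁⟩ ⟨h₂, d₂⟩
    refine ⟨?_, fun β hβ => ?_⟩
    · have e : zeroExt (f₁ + f₂ : closure (Ω : Set (EuclideanSpace ℝ (Fin n))) →ᵇ ℝ) =
        zeroExt f₁ + zeroExt f₂ := zeroExt_add f₁ f₂
      rw [e]
      exact h₁.add h₂
    · obtain ⟨g₁, e₁⟩ := d₁ β hβ
      obtain ⟨g₂, e₂⟩ := d₂ β hβ
      exact ⟨g₁ + g₂, e₁.add (h₁.of_le (by exact_mod_cast hβ)) (h₂.of_le (by exact_mod_cast hβ)) e₂⟩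
  smul_mem' := by
    rintro c f ⟨h, d⟩
    refine ⟨?_, fun β hβ => ?_⟩
    · have e : zeroExt (c • f : closure (Ω : Set (EuclideanSpace ℝ (Fin n))) →ᵇ ℝ) =
        c • zeroExt f := zeroExt_smul c f
      rw [e]
      exact contDiffOn_const.smul h
    · obtain ⟨g, e⟩ := d β hβ
      exact ⟨c • g, e.smul c (h.of_le (by exact_mod_cast hβ))⟩

section deriv

variable {Ω : Opens (EuclideanSpace ℝ (Fin n))} {m : ℕ∞}
  {f g : closure (Ω : Set (EuclideanSpace ℝ (Fin n))) →ᵇ ℝ}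

lemma isClosureDeriv_closureDeriv (hf : f ∈ cmSubmodule m Ω) (β : Fin n → ℕ)
    (hβ : ((∑ i, β i : ℕ) : ℕ∞) ≤ m) : IsClosureDeriv β f (closureDeriv β f) := by
  obtain ⟨g, h⟩ := hf.2 β hβ
  rw [h.closureDeriv_eq]
  exact h

lemma closureDeriv_zero_index (f : closure (Ω : Set (EuclideanSpace ℝ (Fin n))) →ᵇ ℝ) :
    closureDeriv 0 f = f := (isClosureDeriv_zero_index f).closureDeriv_eq

lemma closureDeriv_zero (β : Fin n → ℕ) :
    closureDeriv β (0 : closure (Ω : Set (EuclideanSpace ℝ (Fin n))) →ᵇ ℝ) = 0 :=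
  (isClosureDeriv_zero β).closureDeriv_eq

lemma closureDeriv_add (hf : f ∈ cmSubmodule m Ω) (hg : g ∈ cmSubmodule m Ω) (β : Fin n → ℕ)
    (hβ : ((∑ i, β i : ℕ) : ℕ∞) ≤ m) :
    closureDeriv β (f + g) = closureDeriv β f + closureDeriv β g :=
  ((isClosureDeriv_closureDeriv hf β hβ).add (hf.1.of_le (by exact_mod_cast hβ))
    (hg.1.of_le (by exact_mod_cast hβ)) (isClosureDeriv_closureDeriv hg β hβ)).closureDeriv_eq

lemma closureDeriv_smul (c : ℝ) (hf : f ∈ cmSubmodule m Ω) (β : Fin n → ℕ)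
    (hβ : ((∑ i, β i : ℕ) : ℕ∞) ≤ m) :
    closureDeriv β (c • f) = c • closureDeriv β f :=
  ((isClosureDeriv_closureDeriv hf β hβ).smul c
    (hf.1.of_le (by exact_mod_cast hβ))).closureDeriv_eq

end deriv

/-! ### Schauder spaces -/

/-- The Schauder space `C^{m,α}(cl Ω)` as a subspace: the functions of `C^m(cl Ω)` whose
derivatives of order `m` are Hölder continuous with exponent `α`. -/
def schauderSubmodule (m : ℕ) (α : ℝ≥0) (Ω : Opens (EuclideanSpace ℝ (Fin n))) :
    Submodule ℝ (closure (Ω : Set (EuclideanSpace ℝ (Fin n))) →ᵇ ℝ) where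
  carrier := {f | f ∈ cmSubmodule (m : ℕ∞) Ω ∧
    ∀ β : Fin n → ℕ, ∑ i, β i = m → MemHolder α (closureDeriv β f)}
  zero_mem' := ⟨Submodule.zero_mem _, fun β _ => by
    rw [closureDeriv_zero]
    exact memHolder_zero⟩
  add_mem' := by
    rintro f g ⟨hf, df⟩ ⟨hg, dg⟩
    refine ⟨Submodule.add_mem _ hf hg, fun β hβ => ?_⟩
    rw [closureDeriv_add hf hg β (by exact_mod_cast hβ.le)]
    exact (df β hβ).add (dg β hβ)
  smul_mem' := by
    rintro c f ⟨hf, df⟩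
    refine ⟨Submodule.smul_mem _ c hf, fun β hβ => ?_⟩
    rw [closureDeriv_smul c hf β (by exact_mod_cast hβ.le)]
    exact (df β hβ).smul

/-- The Schauder space `C^{m,α}(cl Ω)`. It carries the Schauder norm, see below. -/
def Schauder (m : ℕ) (α : ℝ≥0) (Ω : Opens (EuclideanSpace ℝ (Fin n))) : Type :=
  schauderSubmodule m α Ω

/-- The finite set of the multi-indices of order `j`. -/
def multiIdx (n j : ℕ) : Finset (Fin n → ℕ) := Finset.piAntidiag Finset.univ j

lemma mem_multiIdx {j : ℕ} {β : Fin n → ℕ} : β ∈ multiIdx n j ↔ ∑ i, β i = j := by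
  simp [multiIdx]

namespace Schauder

variable {m : ℕ} {α : ℝ≥0} {Ω : Opens (EuclideanSpace ℝ (Fin n))}

instance : AddCommGroup (Schauder m α Ω) := inferInstanceAs (AddCommGroup (schauderSubmodule m α Ω))

instance : Module ℝ (Schauder m α Ω) := inferInstanceAs (Module ℝ (schauderSubmodule m α Ω))

/-- The underlying bounded continuous function on the closure of `Ω`. -/
def toBCF (f : Schauder m α Ω) : closure (Ω : Set (EuclideanSpace ℝ (Fin n))) →ᵇ ℝ :=
  Subtype.val f

lemma mem (f : Schauder m α Ω) : f.toBCF ∈ schauderSubmodule m α Ω := Subtype.property f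

instance : FunLike (Schauder m α Ω) (closure (Ω : Set (EuclideanSpace ℝ (Fin n)))) ℝ where
  coe f := f.toBCF
  coe_injective _ _ h := Subtype.ext (DFunLike.coe_injective h)

/-- The usual norm of `C^{m,α}(cl Ω)`:
`∑_{|β| ≤ m} sup |D^β f| + ∑_{|β| = m} |D^β f|_α`, where `|·|_α` is the Hölder seminorm. -/
instance : Norm (Schauder m α Ω) where
  norm f := (∑ j ∈ Finset.range (m + 1), ∑ β ∈ multiIdx n j, ‖closureDeriv β f.toBCF‖) +
    ∑ β ∈ multiIdx n m, (nnHolderNorm α (closureDeriv β f.toBCF) : ℝ)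

lemma norm_def (f : Schauder m α Ω) :
    ‖f‖ = (∑ j ∈ Finset.range (m + 1), ∑ β ∈ multiIdx n j, ‖closureDeriv β f.toBCF‖) +
      ∑ β ∈ multiIdx n m, (nnHolderNorm α (closureDeriv β f.toBCF) : ℝ) := rfl

lemma le_of_mem {j : ℕ} (hj : j ∈ Finset.range (m + 1)) {β : Fin n → ℕ}
    (hβ : β ∈ multiIdx n j) : ((∑ i, β i : ℕ) : ℕ∞) ≤ (m : ℕ∞) := by
  rw [mem_multiIdx.1 hβ]
  exact_mod_cast Nat.lt_succ_iff.1 (Finset.mem_range.1 hj)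

lemma normCore : NormedSpace.Core ℝ (Schauder m α Ω) where
  norm_nonneg f := by
    rw [norm_def]
    positivity
  norm_smul c f := by
    have e : (c • f).toBCF = c • f.toBCF := rfl
    simp only [norm_def, e, mul_add, Finset.mul_sum]
    refine congrArg₂ _ (Finset.sum_congr rfl fun j hj => Finset.sum_congr rfl fun β hβ => ?_)
      (Finset.sum_congr rfl fun β hβ => ?_)
    · rw [closureDeriv_smul c f.mem.1 β (le_of_mem hj hβ), norm_smul]
    · rw [closureDeriv_smul c f.mem.1 β (le_of_mem (Finset.self_mem_range_succ m) hβ),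
        BoundedContinuousFunction.coe_smul]
      have h := (f.mem.2 β (mem_multiIdx.1 hβ)).nnHolderNorm_smul c
      have h' : nnHolderNorm α (fun x => c • closureDeriv β f.toBCF x) =
        ‖c‖₊ * nnHolderNorm α (closureDeriv β f.toBCF) := h
      rw [h']
      simp
  norm_triangle f g := by
    have e : (f + g).toBCF = f.toBCF + g.toBCF := rfl
    simp only [norm_def, e]
    rw [add_add_add_comm, ← Finset.sum_add_distrib, ← Finset.sum_add_distrib]
    refine add_le_add (Finset.sum_le_sum fun j hj => ?_) (Finset.sum_le_sum fun β hβ => ?_)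
    · rw [← Finset.sum_add_distrib]
      refine Finset.sum_le_sum fun β hβ => ?_
      rw [closureDeriv_add f.mem.1 g.mem.1 β (le_of_mem hj hβ)]
      exact norm_add_le _ _
    · rw [closureDeriv_add f.mem.1 g.mem.1 β (le_of_mem (Finset.self_mem_range_succ m) hβ)]
      exact_mod_cast (f.mem.2 β (mem_multiIdx.1 hβ)).nnHolderNorm_add_le
        (g.mem.2 β (mem_multiIdx.1 hβ))
  norm_eq_zero_iff f := by
    constructor
    · intro h
      have h1 : ‖closureDeriv 0 f.toBCF‖ ≤ ‖f‖ := by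
        rw [norm_def]
        have a : ‖closureDeriv 0 f.toBCF‖ ≤ ∑ β ∈ multiIdx n 0, ‖closureDeriv β f.toBCF‖ :=
          Finset.single_le_sum (f := fun β => ‖closureDeriv β f.toBCF‖)
            (fun _ _ => norm_nonneg _) (mem_multiIdx.2 (by simp))
        have b := Finset.single_le_sum
          (f := fun j => ∑ β ∈ multiIdx n j, ‖closureDeriv β f.toBCF‖)
          (fun _ _ => by positivity) (Finset.mem_range.2 (Nat.succ_pos m))
        have c : 0 ≤ ∑ β ∈ multiIdx n m, (nnHolderNorm α (closureDeriv β f.toBCF) : ℝ) := by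
          positivity
        exact (a.trans b).trans (le_add_of_nonneg_right c)
      rw [h, closureDeriv_zero_index] at h1
      exact Subtype.ext (norm_le_zero_iff.1 h1)
    · rintro rfl
      have e : (0 : Schauder m α Ω).toBCF = 0 := rfl
      have z : nnHolderNorm α
          (fun _ => 0 : closure (Ω : Set (EuclideanSpace ℝ (Fin n))) → ℝ) = 0 :=
        nnHolderNorm_zero _ α
      simp [norm_def, e, closureDeriv_zero, Pi.zero_def, z]

instance : NormedAddCommGroup (Schauder m α Ω) := NormedAddCommGroup.ofCore normCore

instance : NormedSpace ℝ (Schauder m α Ω) := NormedSpace.ofCore normCore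

/-- The point `v(x)`, for `v = (v₁, …, vᵣ) ∈ (C^{m,α}(cl Ω))^r` and `x ∈ cl Ω`. -/
def eval {r : ℕ} (v : Fin r → Schauder m α Ω)
    (x : closure (Ω : Set (EuclideanSpace ℝ (Fin n)))) : EuclideanSpace ℝ (Fin r) :=
  WithLp.toLp 2 fun i => v i x

end Schauder

/-- `C^{m,α}(cl Ω, D) = {v ∈ (C^{m,α}(cl Ω))^r : v(cl Ω) ⊆ D}`. -/
def schauderInto {r : ℕ} (m : ℕ) (α : ℝ≥0) (Ω : Opens (EuclideanSpace ℝ (Fin n)))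
    (D : Set (EuclideanSpace ℝ (Fin r))) : Set (Fin r → Schauder m α Ω) :=
  {v | ∀ x, Schauder.eval v x ∈ D}

/-! ### Roumieu classes -/

/-- The weighted norm `(ρ^|β| / |β|!) sup |D^β u|`. -/
def roumieuTerm {Ω : Opens (EuclideanSpace ℝ (Fin n))} (ρ : ℝ)
    (u : closure (Ω : Set (EuclideanSpace ℝ (Fin n))) →ᵇ ℝ) (β : Fin n → ℕ) : ℝ :=
  ρ ^ (∑ i, β i) / (Nat.factorial (∑ i, β i) : ℝ) * ‖closureDeriv β u‖

section roumieuTerm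

variable {Ω : Opens (EuclideanSpace ℝ (Fin n))} {ρ : ℝ}
  {u v : closure (Ω : Set (EuclideanSpace ℝ (Fin n))) →ᵇ ℝ}

lemma roumieuTerm_zero (β : Fin n → ℕ) :
    roumieuTerm ρ (0 : closure (Ω : Set (EuclideanSpace ℝ (Fin n))) →ᵇ ℝ) β = 0 := by
  simp [roumieuTerm, closureDeriv_zero]

lemma roumieuTerm_nonneg (hρ : 0 < ρ) (β : Fin n → ℕ) : 0 ≤ roumieuTerm ρ u β := by
  rw [roumieuTerm]
  positivity

lemma roumieuTerm_add_le (hρ : 0 < ρ) (hu : u ∈ cmSubmodule ⊤ Ω) (hv : v ∈ cmSubmodule ⊤ Ω)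
    (β : Fin n → ℕ) :
    roumieuTerm ρ (u + v) β ≤ roumieuTerm ρ u β + roumieuTerm ρ v β := by
  rw [roumieuTerm, roumieuTerm, roumieuTerm, closureDeriv_add hu hv β le_top, ← mul_add]
  exact mul_le_mul_of_nonneg_left (norm_add_le _ _) (by positivity)

lemma roumieuTerm_smul (c : ℝ) (hu : u ∈ cmSubmodule ⊤ Ω) (β : Fin n → ℕ) :
    roumieuTerm ρ (c • u) β = ‖c‖ * roumieuTerm ρ u β := by
  rw [roumieuTerm, roumieuTerm, closureDeriv_smul c hu β le_top, norm_smul]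
  ring

end roumieuTerm

/-- The Roumieu class `C⁰_{ω,ρ}(cl Ω)` as a subspace: the functions `u` of `C^∞(cl Ω)` such that
`sup_β (ρ^|β| / |β|!) sup |D^β u|` is finite. -/
def roumieuSubmodule (ρ : {ρ : ℝ // 0 < ρ}) (Ω : Opens (EuclideanSpace ℝ (Fin n))) :
    Submodule ℝ (closure (Ω : Set (EuclideanSpace ℝ (Fin n))) →ᵇ ℝ) where
  carrier := {u | u ∈ cmSubmodule ⊤ Ω ∧ BddAbove (Set.range (roumieuTerm (ρ : ℝ) u))}
  zero_mem' := ⟨Submodule.zero_mem _, ⟨0, by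
    rintro _ ⟨β, rfl⟩
    rw [roumieuTerm_zero]⟩⟩
  add_mem' := by
    rintro u v ⟨hu, A, hA⟩ ⟨hv, B, hB⟩
    refine ⟨Submodule.add_mem _ hu hv, A + B, ?_⟩
    rintro _ ⟨β, rfl⟩
    exact (roumieuTerm_add_le ρ.2 hu hv β).trans (add_le_add (hA ⟨β, rfl⟩) (hB ⟨β, rfl⟩))
  smul_mem' := by
    rintro c u ⟨hu, A, hA⟩
    refine ⟨Submodule.smul_mem _ c hu, ‖c‖ * A, ?_⟩
    rintro _ ⟨β, rfl⟩
    rw [roumieuTerm_smul c hu]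
    exact mul_le_mul_of_nonneg_left (hA ⟨β, rfl⟩) (norm_nonneg c)

/-- The Roumieu class `C⁰_{ω,ρ}(cl Ω)`. It carries the Roumieu norm, see below. -/
def Roumieu (ρ : {ρ : ℝ // 0 < ρ}) (Ω : Opens (EuclideanSpace ℝ (Fin n))) : Type :=
  roumieuSubmodule ρ Ω

namespace Roumieu

variable {ρ : {ρ : ℝ // 0 < ρ}} {Ω : Opens (EuclideanSpace ℝ (Fin n))}

instance : AddCommGroup (Roumieu ρ Ω) := inferInstanceAs (AddCommGroup (roumieuSubmodule ρ Ω))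

instance : Module ℝ (Roumieu ρ Ω) := inferInstanceAs (Module ℝ (roumieuSubmodule ρ Ω))

/-- The underlying bounded continuous function on the closure of `Ω`. -/
def toBCF (u : Roumieu ρ Ω) : closure (Ω : Set (EuclideanSpace ℝ (Fin n))) →ᵇ ℝ :=
  Subtype.val u

lemma mem (u : Roumieu ρ Ω) : u.toBCF ∈ roumieuSubmodule ρ Ω := Subtype.property u

instance : FunLike (Roumieu ρ Ω) (closure (Ω : Set (EuclideanSpace ℝ (Fin n)))) ℝ where
  coe u := u.toBCF
  coe_injective _ _ h := Subtype.ext (DFunLike.coe_injective h)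

/-- The norm of the Roumieu class: `sup_β (ρ^|β| / |β|!) sup |D^β u|`. -/
instance : Norm (Roumieu ρ Ω) where
  norm u := ⨆ β : Fin n → ℕ, roumieuTerm (ρ : ℝ) u.toBCF β

lemma norm_def (u : Roumieu ρ Ω) : ‖u‖ = ⨆ β : Fin n → ℕ, roumieuTerm (ρ : ℝ) u.toBCF β := rfl

lemma roumieuTerm_le_norm (u : Roumieu ρ Ω) (β : Fin n → ℕ) :
    roumieuTerm (ρ : ℝ) u.toBCF β ≤ ‖u‖ := le_ciSup u.mem.2 β

lemma normCore : NormedSpace.Core ℝ (Roumieu ρ Ω) where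
  norm_nonneg u := (roumieuTerm_nonneg ρ.2 0).trans (u.roumieuTerm_le_norm 0)
  norm_smul c u := by
    have e : (c • u).toBCF = c • u.toBCF := rfl
    rw [norm_def, norm_def, e, Real.mul_iSup_of_nonneg (norm_nonneg c)]
    exact congrArg _ (funext fun β => roumieuTerm_smul c u.mem.1 β)
  norm_triangle u v := ciSup_le fun β => (roumieuTerm_add_le ρ.2 u.mem.1 v.mem.1 β).trans
    (add_le_add (u.roumieuTerm_le_norm β) (v.roumieuTerm_le_norm β))
  norm_eq_zero_iff u := by
    constructor
    · intro h
      have h1 := u.roumieuTerm_le_norm 0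
      rw [h, roumieuTerm, closureDeriv_zero_index] at h1
      have h2 : ‖u.toBCF‖ ≤ 0 := by simpa using h1
      exact Subtype.ext (norm_le_zero_iff.1 h2)
    · rintro rfl
      have e : (0 : Roumieu ρ Ω).toBCF = 0 := rfl
      simp [norm_def, e, roumieuTerm_zero]

instance : NormedAddCommGroup (Roumieu ρ Ω) := NormedAddCommGroup.ofCore normCore

instance : NormedSpace ℝ (Roumieu ρ Ω) := NormedSpace.ofCore normCore

end Roumieu

/-- `Ω` is of class `C^m`: near each boundary point there is a `C^m` diffeomorphism between open
sets of the space that takes `Ω` to the points of an open half space, and `∂Ω` to the points of the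
hyperplane that bounds it. -/
def IsOfClass (m : ℕ) (Ω : Set (EuclideanSpace ℝ (Fin n))) : Prop :=
  ∀ x ∈ frontier Ω,
    ∃ (ψ : OpenPartialHomeomorph (EuclideanSpace ℝ (Fin n)) (EuclideanSpace ℝ (Fin n)))
      (i : Fin n), x ∈ ψ.source ∧
      ContDiffOn ℝ m ψ ψ.source ∧ ContDiffOn ℝ m ψ.symm ψ.target ∧
      (∀ y ∈ ψ.source, y ∈ Ω ↔ 0 < ψ y i) ∧ (∀ y ∈ ψ.source, y ∈ frontier Ω ↔ ψ y i = 0)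

end SchauderRoumieu

end

open SchauderRoumieu

/-!
For fixed `v`, the map `u ↦ u ∘ v` is linear, so the theorem reduces to the analyticity of
`S : v ↦ (u ↦ u ∘ v)` as a map from `C^{m,α}(cl Ω', Ω)` to the space of continuous linear operators
from `C⁰_{ω,ρ}(cl Ω)` to `C^{m,α}(cl Ω')`; then `T[u,v] = S(v) u` is analytic too. Near `v`, the map
`S` is the sum of the Taylor series

`S(v + w) u = ∑_N (1/N!) ∑_{j₁, …, j_N} w_{j₁} ⋯ w_{j_N} · (∂_{j₁} ⋯ ∂_{j_N} u) ∘ v`.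

Four facts make this work.

* On a bounded domain of class `C¹` the space `C^{m,α}` is complete and multiplication is continuous
  (`Schauder.exists_mulL`). Both are proved by induction on `m`, through the description of
  `C^{m+1,α}` as the functions with gradient in `C^{m,α}` (`Schauder.exists_of_hasFDerivAt`,
  `Schauder.norm_succ_le`). The regularity of the domain enters only in the embedding of
  `C^{m+1,α}` in `C^{m,α}` (`Schauder.exists_inclusion`): a function with bounded gradient is
  Lipschitz near each point, as is seen in a chart, and a compactness argument makes the estimate
  global, since two points at a distance bounded from below are dealt with by the supremum of the
  function (`exists_lipschitz_const`).
* If `U` is smooth on `Ω`, then `U ∘ v` is in `C^{m,α}`, with norm at most `C_v` times the supremum of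
  the derivatives of `U` of order at most `m + 1` (`exists_comp`): induction on `m` and the chain
  rule. No regularity of `Ω` is needed, as the image of `v` is a compact subset of `Ω`.
* The Roumieu bounds `|D_w u| ≤ ‖u‖ |w|! / ρ^|w|` are stable under `m + 1` further derivatives up to
  geometric factors, so the operators `u ↦ (D_w u) ∘ v` have norms at most `C q^|w| |w|!`
  (`Roumieu.exists_compL`), and the series above has a positive radius of convergence.
* By completeness the series converges in operator norm, so its sum has to be identified at each
  point of `cl Ω'` only, where it is Taylor's formula for `u` (`tendsto_sum_wordForm`).

Derivatives are indexed by words in the coordinates (`wordD`) rather than by multi-indices, which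
suits the inductions and the multilinear terms of the series; symmetry of second derivatives links
the two (`partialD_wordIdx`).
-/

noncomputable section

namespace SchauderRoumieu

/-! ### Partial derivatives along words -/

section

variable {n : ℕ}

/-- The partial derivative `∂ᵢ F`. -/
def pd (i : Fin n) (F : EuclideanSpace ℝ (Fin n) → ℝ) : EuclideanSpace ℝ (Fin n) → ℝ :=
  fun x => fderiv ℝ F x (EuclideanSpace.single i (1 : ℝ))

/-- The iterated partial derivative `∂_{i₁} ⋯ ∂_{iᵣ} F`, for a word `w = [i₁, …, iᵣ]`. -/
def wordD (w : List (Fin n)) (F : EuclideanSpace ℝ (Fin n) → ℝ) : EuclideanSpace ℝ (Fin n) → ℝ :=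
  w.foldr pd F

@[simp] lemma wordD_nil (F : EuclideanSpace ℝ (Fin n) → ℝ) : wordD [] F = F := rfl

lemma wordD_cons (i : Fin n) (w : List (Fin n)) (F : EuclideanSpace ℝ (Fin n) → ℝ) :
    wordD (i :: w) F = pd i (wordD w F) := rfl

lemma wordD_append (w w' : List (Fin n)) (F : EuclideanSpace ℝ (Fin n) → ℝ) :
    wordD (w ++ w') F = wordD w (wordD w' F) := List.foldr_append

variable {s : Set (EuclideanSpace ℝ (Fin n))} {F G : EuclideanSpace ℝ (Fin n) → ℝ}

lemma pd_eqOn (hs : IsOpen s) (h : Set.EqOn F G s) (i : Fin n) :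
    Set.EqOn (pd i F) (pd i G) s := fun x hx => by
  rw [pd, pd, (h.eventuallyEq_of_mem (hs.mem_nhds hx)).fderiv_eq]

lemma contDiffOn_pd (hs : IsOpen s) {N M : WithTop ℕ∞} (hF : ContDiffOn ℝ N F s)
    (h : M + 1 ≤ N) (i : Fin n) : ContDiffOn ℝ M (pd i F) s :=
  (hF.fderiv_of_isOpen hs h).clm_apply contDiffOn_const

lemma contDiffOn_wordD (hs : IsOpen s) {N M : WithTop ℕ∞} (hF : ContDiffOn ℝ N F s)
    (w : List (Fin n)) (h : M + w.length ≤ N) : ContDiffOn ℝ M (wordD w F) s := by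
  induction w generalizing M with
  | nil => exact hF.of_le (by simpa using h)
  | cons i w ih =>
    refine contDiffOn_pd hs (ih (M := M + 1) ?_) le_rfl i
    rw [add_assoc, add_comm 1]
    simpa using h

lemma eq_sum_smul_proj (L : EuclideanSpace ℝ (Fin n) →L[ℝ] ℝ) :
    L = ∑ i, L (EuclideanSpace.single i 1) • EuclideanSpace.proj (𝕜 := ℝ) i := by
  ext x
  have hx : x = ∑ i, x i • EuclideanSpace.single i (1 : ℝ) := by
    simpa using ((EuclideanSpace.basisFun (Fin n) ℝ).sum_repr x).symm
  conv_lhs => rw [hx]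
  simp [mul_comm]

lemma fderiv_eq_sum_pd (F : EuclideanSpace ℝ (Fin n) → ℝ) (x : EuclideanSpace ℝ (Fin n)) :
    fderiv ℝ F x = ∑ i, pd i F x • EuclideanSpace.proj (𝕜 := ℝ) i := eq_sum_smul_proj _

lemma norm_sum_smul_proj_le (a : Fin n → ℝ) :
    ‖∑ i, a i • (EuclideanSpace.proj (𝕜 := ℝ) i : EuclideanSpace ℝ (Fin n) →L[ℝ] ℝ)‖ ≤
      ∑ i, |a i| := by
  refine (norm_sum_le _ _).trans (Finset.sum_le_sum fun i _ => ?_)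
  rw [norm_smul, Real.norm_eq_abs]
  refine mul_le_of_le_one_right (abs_nonneg _) ?_
  refine ContinuousLinearMap.opNorm_le_bound _ zero_le_one fun x => ?_
  rw [one_mul]
  exact PiLp.norm_apply_le x i

lemma pd_comm (hs : IsOpen s) (hF : ContDiffOn ℝ 2 F s) (i j : Fin n) :
    Set.EqOn (pd i (pd j F)) (pd j (pd i F)) s := fun x hx => by
  have h2 : ContDiffAt ℝ 2 F x := hF.contDiffAt (hs.mem_nhds hx)
  have hd : DifferentiableAt ℝ (fderiv ℝ F) x :=
    (h2.fderiv_right (m := 1) (by norm_num [one_add_one_eq_two])).differentiableAt (by simp)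
  have key : ∀ a b : Fin n, pd a (pd b F) x =
      fderiv ℝ (fderiv ℝ F) x (EuclideanSpace.single a 1) (EuclideanSpace.single b 1) := by
    intro a b
    rw [pd]
    change fderiv ℝ (fun y => fderiv ℝ F y (EuclideanSpace.single b 1)) x _ = _
    rw [fderiv_clm_apply hd (differentiableAt_const _)]
    simp
  rw [key, key]
  exact (h2.isSymmSndFDerivAt (by simp)).eq _ _

lemma wordD_perm (hs : IsOpen s) {N : ℕ} (hF : ContDiffOn ℝ N F s) {w w' : List (Fin n)}
    (h : w.Perm w') (hw : w.length ≤ N) : Set.EqOn (wordD w F) (wordD w' F) s := by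
  induction h with
  | nil => exact fun _ _ => rfl
  | cons i _ ih => exact pd_eqOn hs (ih (by simp at hw; omega)) i
  | swap i j w =>
    refine pd_comm hs (contDiffOn_wordD hs hF w ?_) j i
    simp only [List.length_cons] at hw
    rw [add_comm]
    exact_mod_cast hw
  | trans h₁ _ ih₁ ih₂ => exact (ih₁ hw).trans (ih₂ (h₁.length_eq ▸ hw))

lemma iteratedFDeriv_single_eq_wordD (hs : IsOpen s) {N : ℕ} (hF : ContDiffOn ℝ N F s)
    (t : Fin N → Fin n) : ∀ x ∈ s,
    iteratedFDeriv ℝ N F x (fun j => EuclideanSpace.single (t j) (1 : ℝ)) =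
      wordD (List.ofFn t) F x := by
  induction N with
  | zero => intro x _; simp
  | succ N ih =>
    intro x hx
    have hF' : ContDiffOn ℝ N F s := hF.of_le (by exact_mod_cast Nat.le_succ N)
    rw [iteratedFDeriv_succ_apply_left, List.ofFn_succ, wordD_cons,
      ← fderiv_continuousMultilinear_apply_const_apply]
    · rw [pd]
      congr 1
      refine Filter.EventuallyEq.fderiv_eq ?_
      filter_upwards [hs.mem_nhds hx] with y hy
      exact ih hF' (fun j => t j.succ) y hy
    · exact (hF.contDiffAt (hs.mem_nhds hx)).differentiableAt_iteratedFDeriv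
        (by exact_mod_cast Nat.lt_succ_self N)

lemma count_ofFn_finSigmaFinEquiv (β : Fin n → ℕ) (i : Fin n) :
    (List.ofFn fun j : Fin (∑ i, β i) => (finSigmaFinEquiv.symm j).1).count i = β i := by
  rw [← Multiset.coe_count, ← Fin.univ_val_map, Multiset.count_map]
  change (Finset.univ.filter fun j : Fin (∑ i, β i) => i = (finSigmaFinEquiv.symm j).1).card = _
  rw [← Fintype.card_subtype]
  have e : {j : Fin (∑ i, β i) // i = (finSigmaFinEquiv.symm j).1} ≃ Fin (β i) :=
    (finSigmaFinEquiv.symm.subtypeEquiv (q := fun p : (i : Fin n) × Fin (β i) => p.1 = i)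
      fun j => eq_comm).trans (Equiv.sigmaSubtype i)
  rw [Fintype.card_congr e, Fintype.card_fin]

/-- The multi-index of a word. -/
def wordIdx (w : List (Fin n)) : Fin n → ℕ := fun i => w.count i

lemma sum_wordIdx (w : List (Fin n)) : ∑ i, wordIdx w i = w.length := by
  simpa [wordIdx] using (Multiset.sum_count_eq_card (s := Finset.univ) (m := (w : Multiset (Fin n))))

/-- By the symmetry of the second differential, `D^β F` is the iterated partial derivative along
any word in which the letter `i` occurs `βᵢ` times. -/
lemma partialD_wordIdx (hs : IsOpen s) {w : List (Fin n)} (hF : ContDiffOn ℝ w.length F s)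
    {x : EuclideanSpace ℝ (Fin n)} (hx : x ∈ s) : partialD (wordIdx w) F x = wordD w F x := by
  have hF' : ContDiffOn ℝ (∑ i, wordIdx w i : ℕ) F s := by rwa [sum_wordIdx]
  rw [partialD, iteratedFDeriv_single_eq_wordD hs hF' _ x hx]
  refine wordD_perm hs hF' ?_ (by simp) hx
  rw [List.perm_iff_count]
  exact count_ofFn_finSigmaFinEquiv _

lemma exists_wordIdx_eq (β : Fin n → ℕ) : ∃ w : List (Fin n), wordIdx w = β :=
  ⟨_, funext (count_ofFn_finSigmaFinEquiv β)⟩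

lemma wordIdx_append_singleton (w : List (Fin n)) (i : Fin n) :
    wordIdx (w ++ [i]) = wordIdx w + Pi.single i 1 := by
  funext j
  rcases eq_or_ne j i with rfl | hij
  · simp [wordIdx]
  · simp [wordIdx, hij, hij.symm]

lemma partialD_add_single (hs : IsOpen s) {β : Fin n → ℕ} {i : Fin n}
    (hF : ContDiffOn ℝ (∑ j, β j + 1 : ℕ) F s) {x : EuclideanSpace ℝ (Fin n)} (hx : x ∈ s) :
    partialD (β + Pi.single i 1) F x = partialD β (pd i F) x := by
  obtain ⟨w, rfl⟩ := exists_wordIdx_eq β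
  rw [sum_wordIdx] at hF
  rw [← wordIdx_append_singleton, partialD_wordIdx hs (by simpa using hF) hx,
    partialD_wordIdx hs (contDiffOn_pd hs hF (by simp) i) hx, wordD_append]
  rfl

lemma partialD_eqOn (hs : IsOpen s) (h : Set.EqOn F G s) (β : Fin n → ℕ) :
    Set.EqOn (partialD β F) (partialD β G) s := fun x hx => by
  rw [partialD, partialD, (h.eventuallyEq_of_mem (hs.mem_nhds hx)).iteratedFDeriv ℝ _ |>.eq_of_nhds]

end

/-! ### The Schauder space of order `m + 1` in terms of the one of order `m` -/

section

variable {n : ℕ}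

lemma exists_eq_add_single {j : ℕ} {β : Fin n → ℕ} (hβ : ∑ i, β i = j + 1) :
    ∃ i, ∃ β' : Fin n → ℕ, ∑ i, β' i = j ∧ β = β' + Pi.single i 1 := by
  obtain ⟨w, rfl⟩ := exists_wordIdx_eq β
  rw [sum_wordIdx] at hβ
  obtain ⟨w', i, rfl⟩ : ∃ w' i, w = w' ++ [i] :=
    ⟨w.dropLast, w.getLast (by rintro rfl; simp at hβ), (List.dropLast_append_getLast _).symm⟩
  refine ⟨i, wordIdx w', ?_, wordIdx_append_singleton _ _⟩
  rw [sum_wordIdx]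
  simpa using hβ

lemma sum_add_single (β : Fin n → ℕ) (i : Fin n) :
    ∑ j, (β + Pi.single i 1 : Fin n → ℕ) j = ∑ j, β j + 1 := by
  simp [Finset.sum_add_distrib]

lemma sum_multiIdx_succ_le (j : ℕ) {a : (Fin n → ℕ) → ℝ} (ha : ∀ β, 0 ≤ a β) :
    ∑ β ∈ multiIdx n (j + 1), a β ≤ ∑ i, ∑ β ∈ multiIdx n j, a (β + Pi.single i 1) := by
  classical
  rw [← Finset.sum_product']
  refine le_trans (Finset.sum_le_sum_of_subset_of_nonneg (t := (Finset.univ ×ˢ multiIdx n j).image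
    fun p : Fin n × (Fin n → ℕ) => p.2 + Pi.single p.1 1) ?_ fun β _ _ => ha β) ?_
  · intro β hβ
    obtain ⟨i, β', h, rfl⟩ := exists_eq_add_single (mem_multiIdx.1 hβ)
    exact Finset.mem_image.2 ⟨(i, β'), by simp [mem_multiIdx, h], rfl⟩
  · exact Finset.sum_image_le_of_nonneg (fun _ _ => ha _)

lemma sum_multiIdx_add_single_le (j : ℕ) {a : (Fin n → ℕ) → ℝ} (ha : ∀ β, 0 ≤ a β) (i : Fin n) :
    ∑ β ∈ multiIdx n j, a (β + Pi.single i 1) ≤ ∑ β ∈ multiIdx n (j + 1), a β := by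
  classical
  rw [← Finset.sum_image (f := a) (g := fun β : Fin n → ℕ => β + Pi.single i 1)
    fun _ _ _ _ h => add_right_cancel h]
  refine Finset.sum_le_sum_of_subset_of_nonneg ?_ fun β _ _ => ha β
  intro β hβ
  obtain ⟨β', h, rfl⟩ := Finset.mem_image.1 hβ
  rw [mem_multiIdx, sum_add_single, mem_multiIdx.1 h]

variable {Ω : Opens (EuclideanSpace ℝ (Fin n))}
  {f g : closure (Ω : Set (EuclideanSpace ℝ (Fin n))) →ᵇ ℝ} {m : ℕ}

lemma zeroExt_of_mem (f : closure (Ω : Set (EuclideanSpace ℝ (Fin n))) → ℝ)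
    {x : EuclideanSpace ℝ (Fin n)} (hx : x ∈ Ω) : zeroExt f x = f ⟨x, subset_closure hx⟩ :=
  zeroExt_apply f ⟨x, subset_closure hx⟩

lemma IsClosureDeriv.eqOn_pd {i : Fin n} (hf : ContDiffOn ℝ 1 (zeroExt f) Ω)
    (h : IsClosureDeriv (Pi.single i 1) f g) : Set.EqOn (zeroExt g) (pd i (zeroExt f)) Ω := by
  intro x hx
  rw [zeroExt_of_mem _ hx, h ⟨x, subset_closure hx⟩ hx, ← zero_add (Pi.single i 1 : Fin n → ℕ),
    partialD_add_single Ω.isOpen (by simpa using hf) hx, partialD_zero]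

/-- If `g` extends `∂ᵢ f`, the extensions of `D^{β + eᵢ} f` are those of `D^β g`. -/
lemma isClosureDeriv_add_single_iff {i : Fin n} {β : Fin n → ℕ}
    (hf : ContDiffOn ℝ (∑ j, β j + 1 : ℕ) (zeroExt f) Ω)
    (h : Set.EqOn (zeroExt g) (pd i (zeroExt f)) Ω)
    {u : closure (Ω : Set (EuclideanSpace ℝ (Fin n))) →ᵇ ℝ} :
    IsClosureDeriv (β + Pi.single i 1) f u ↔ IsClosureDeriv β g u := by
  refine forall_congr' fun x => forall_congr' fun hx => ?_
  rw [partialD_add_single Ω.isOpen hf hx, partialD_eqOn Ω.isOpen h β hx]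

lemma continuousOn_zeroExt (f : closure (Ω : Set (EuclideanSpace ℝ (Fin n))) →ᵇ ℝ) :
    ContinuousOn (zeroExt f) (closure (Ω : Set (EuclideanSpace ℝ (Fin n)))) := by
  rw [continuousOn_iff_continuous_domRestrict]
  exact f.continuous.congr fun x => (zeroExt_apply f x).symm

lemma closureDeriv_single_mem_cm (hf : f ∈ cmSubmodule (m + 1 : ℕ) Ω) (i : Fin n) :
    closureDeriv (Pi.single i 1) f ∈ cmSubmodule m Ω ∧ ∀ β : Fin n → ℕ, ∑ j, β j ≤ m →
      closureDeriv β (closureDeriv (Pi.single i 1) f) = closureDeriv (β + Pi.single i 1) f := by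
  have hf1 : ContDiffOn ℝ (m + 1 : ℕ) (zeroExt f) Ω := hf.1
  have he := (isClosureDeriv_closureDeriv hf (Pi.single i 1) (by simp)).eqOn_pd
    (hf1.of_le (by simp))
  have key : ∀ β : Fin n → ℕ, ∑ j, β j ≤ m → IsClosureDeriv β (closureDeriv (Pi.single i 1) f)
      (closureDeriv (β + Pi.single i 1) f) := fun β hβ => by
    rw [← isClosureDeriv_add_single_iff (hf1.of_le (by exact_mod_cast Nat.succ_le_succ hβ)) he]
    refine isClosureDeriv_closureDeriv hf _ ?_
    rw [sum_add_single]
    exact_mod_cast Nat.succ_le_succ hβ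
  refine ⟨⟨?_, fun β hβ => ⟨_, key β (by exact_mod_cast hβ)⟩⟩, fun β hβ => (key β hβ).closureDeriv_eq⟩
  exact (contDiffOn_pd Ω.isOpen hf1 (by simp) i).congr he

/-- Converse of `closureDeriv_single_mem_cm`: a function whose gradient has components in
`C^m(cl Ω)` belongs to `C^{m+1}(cl Ω)`. -/
lemma mem_cm_succ {g : Fin n → closure (Ω : Set (EuclideanSpace ℝ (Fin n))) →ᵇ ℝ}
    (hg : ∀ i, g i ∈ cmSubmodule m Ω)
    (h : ∀ x ∈ Ω, HasFDerivAt (zeroExt f)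
      (∑ i, zeroExt (g i) x • EuclideanSpace.proj (𝕜 := ℝ) i) x) :
    f ∈ cmSubmodule (m + 1 : ℕ) Ω ∧ ∀ i, closureDeriv (Pi.single i 1) f = g i := by
  have he : ∀ i, Set.EqOn (zeroExt (g i)) (pd i (zeroExt f)) Ω := fun i x hx => by
    rw [pd, (h x hx).fderiv]
    simp
  have hf1 : ContDiffOn ℝ (m + 1 : ℕ) (zeroExt f) Ω := by
    have : ContDiffOn ℝ ((m : WithTop ℕ∞) + 1) (zeroExt f) Ω := by
      rw [contDiffOn_succ_iff_fderiv_of_isOpen Ω.isOpen]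
      refine ⟨fun x hx => (h x hx).differentiableAt.differentiableWithinAt, by simp, ?_⟩
      have hs : ContDiffOn ℝ m (fun x => ∑ i, zeroExt (g i) x •
          (EuclideanSpace.proj (𝕜 := ℝ) i : EuclideanSpace ℝ (Fin n) →L[ℝ] ℝ)) Ω :=
        ContDiffOn.sum fun i _ => ((hg i).1).smul contDiffOn_const
      refine hs.congr fun x hx => ?_
      rw [(h x hx).fderiv]
    exact_mod_cast this
  have key : ∀ i, IsClosureDeriv (Pi.single i 1) f (g i) := fun i => by
    rw [← zero_add (Pi.single i 1 : Fin n → ℕ),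
      isClosureDeriv_add_single_iff (hf1.of_le (by simp)) (he i)]
    exact isClosureDeriv_zero_index _
  refine ⟨⟨hf1, fun β hβ => ?_⟩, fun i => (key i).closureDeriv_eq⟩
  rcases Nat.eq_zero_or_pos (∑ i, β i) with h0 | h0
  · have : β = 0 := by
      funext i
      exact (Finset.sum_eq_zero_iff.1 h0) i (Finset.mem_univ i)
    exact ⟨f, this ▸ isClosureDeriv_zero_index f⟩
  · obtain ⟨j, hj⟩ := Nat.exists_eq_succ_of_ne_zero h0.ne'
    obtain ⟨i, β', hβ', rfl⟩ := exists_eq_add_single hj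
    have hjm : j + 1 ≤ m + 1 := by rw [hj] at hβ; exact_mod_cast hβ
    obtain ⟨u, hu⟩ := (hg i).2 β' (by rw [hβ']; exact_mod_cast Nat.le_of_succ_le_succ hjm)
    refine ⟨u, (isClosureDeriv_add_single_iff (hf1.of_le ?_) (he i)).2 hu⟩
    rw [hβ']
    exact_mod_cast hjm

namespace Schauder

variable {α : ℝ≥0}

lemma coe_toBCF (f : Schauder m α Ω) : ⇑f.toBCF = ⇑f := rfl

lemma ext {f g : Schauder m α Ω} (h : ∀ x, f x = g x) : f = g := DFunLike.ext _ _ h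

@[simp] lemma add_apply (f g : Schauder m α Ω) (x) : (f + g) x = f x + g x := rfl

@[simp] lemma smul_apply (c : ℝ) (f : Schauder m α Ω) (x) : (c • f) x = c * f x := rfl

lemma multiIdx_zero : multiIdx n 0 = {0} := by
  ext β
  simp [mem_multiIdx, funext_iff]

lemma norm_zero_eq (f : Schauder 0 α Ω) : ‖f‖ = ‖f.toBCF‖ + nnHolderNorm α f := by
  rw [norm_def]
  simp [multiIdx_zero, closureDeriv_zero_index, coe_toBCF]

lemma memHolder_zero (f : Schauder 0 α Ω) : MemHolder α f := by
  have := f.mem.2 0 (by simp)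
  rwa [closureDeriv_zero_index] at this

lemma exists_of_memHolder (f : closure (Ω : Set (EuclideanSpace ℝ (Fin n))) →ᵇ ℝ)
    (hf : MemHolder α f) :
    ∃ F : Schauder 0 α Ω, F.toBCF = f := by
  have h0 : ∀ β : Fin n → ℕ, ∑ i, β i = 0 → β = 0 := fun β hβ => by
    funext i
    exact (Finset.sum_eq_zero_iff.1 hβ) i (Finset.mem_univ i)
  refine ⟨⟨f, ⟨contDiffOn_zero.2 ((continuousOn_zeroExt f).mono subset_closure),
    fun β hβ => ⟨f, ?_⟩⟩, fun β hβ => ?_⟩, rfl⟩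
  · rw [h0 β (by simpa using hβ)]
    exact isClosureDeriv_zero_index f
  · rw [h0 β hβ, closureDeriv_zero_index]
    exact hf

/-- The partial derivative `∂ᵢ`, from `C^{m+1,α}(cl Ω)` to `C^{m,α}(cl Ω)`. -/
def derivL (i : Fin n) : Schauder (m + 1) α Ω →L[ℝ] Schauder m α Ω :=
  LinearMap.mkContinuous
    { toFun := fun f => ⟨closureDeriv (Pi.single i 1) f.toBCF,
        (closureDeriv_single_mem_cm f.mem.1 i).1, fun β hβ => by
          rw [(closureDeriv_single_mem_cm f.mem.1 i).2 β hβ.le]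
          exact f.mem.2 _ (by rw [sum_add_single, hβ])⟩
      map_add' := fun f g => Subtype.ext (closureDeriv_add f.mem.1 g.mem.1 _ (by simp))
      map_smul' := fun c f => Subtype.ext (closureDeriv_smul c f.mem.1 _ (by simp)) } 1 fun f => by
    rw [one_mul, norm_def, norm_def, Finset.sum_range_succ' _ (m + 1)]
    have hd := (closureDeriv_single_mem_cm f.mem.1 i).2
    refine add_le_add (le_trans (Finset.sum_le_sum fun j hj => ?_)
      (le_add_of_nonneg_right (by positivity))) ?_
    · refine le_trans (le_of_eq (Finset.sum_congr rfl fun β hβ => ?_))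
        (sum_multiIdx_add_single_le j (a := fun β => ‖closureDeriv β f.toBCF‖)
          (fun _ => norm_nonneg _) i)
      rw [← hd β (by rw [mem_multiIdx.1 hβ]; exact Nat.lt_succ_iff.1 (Finset.mem_range.1 hj))]
      rfl
    · refine le_trans (le_of_eq (Finset.sum_congr rfl fun β hβ => ?_))
        (sum_multiIdx_add_single_le m (a := fun β => (nnHolderNorm α (closureDeriv β f.toBCF) : ℝ))
          (fun _ => NNReal.coe_nonneg _) i)
      rw [← hd β (mem_multiIdx.1 hβ).le]
      rfl

lemma derivL_toBCF (i : Fin n) (f : Schauder (m + 1) α Ω) :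
    (derivL i f).toBCF = closureDeriv (Pi.single i 1) f.toBCF := rfl

lemma norm_derivL_le (i : Fin n) (f : Schauder (m + 1) α Ω) : ‖derivL i f‖ ≤ ‖f‖ := by
  simpa using (derivL i).le_of_opNorm_le (LinearMap.mkContinuous_norm_le _ zero_le_one _) f

lemma norm_toBCF_le (f : Schauder m α Ω) : ‖f.toBCF‖ ≤ ‖f‖ := by
  rw [norm_def, Finset.sum_range_succ', multiIdx_zero, Finset.sum_singleton,
    closureDeriv_zero_index]
  have h : 0 ≤ ∑ β ∈ multiIdx n m, (nnHolderNorm α (closureDeriv β f.toBCF) : ℝ) := by positivity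
  have h' : 0 ≤ ∑ j ∈ Finset.range m, ∑ β ∈ multiIdx n (j + 1), ‖closureDeriv β f.toBCF‖ := by
    positivity
  linarith

lemma norm_apply_le (f : Schauder m α Ω) (x) : |f x| ≤ ‖f‖ :=
  (f.toBCF.norm_coe_le_norm x).trans f.norm_toBCF_le

lemma norm_succ_le (f : Schauder (m + 1) α Ω) :
    ‖f‖ ≤ ‖f.toBCF‖ + ∑ i, ‖derivL i f‖ := by
  have hd := fun i => (closureDeriv_single_mem_cm f.mem.1 i).2
  simp only [norm_def, derivL_toBCF, Finset.sum_add_distrib]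
  rw [Finset.sum_range_succ' _ (m + 1), multiIdx_zero, Finset.sum_singleton,
    closureDeriv_zero_index, add_comm _ ‖f.toBCF‖, add_assoc, Finset.sum_comm]
  refine add_le_add le_rfl (add_le_add (Finset.sum_le_sum fun j hj => ?_) ?_)
  · refine (sum_multiIdx_succ_le j (a := fun β => ‖closureDeriv β f.toBCF‖)
      (fun _ => norm_nonneg _)).trans (le_of_eq ?_)
    refine Finset.sum_congr rfl fun i _ => Finset.sum_congr rfl fun β hβ => ?_
    rw [hd i β (by rw [mem_multiIdx.1 hβ]; exact Nat.lt_succ_iff.1 (Finset.mem_range.1 hj))]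
  · refine (sum_multiIdx_succ_le m (a := fun β => (nnHolderNorm α (closureDeriv β f.toBCF) : ℝ))
      (fun _ => NNReal.coe_nonneg _)).trans (le_of_eq ?_)
    refine Finset.sum_congr rfl fun i _ => Finset.sum_congr rfl fun β hβ => ?_
    rw [hd i β (mem_multiIdx.1 hβ).le]

lemma hasFDerivAt (f : Schauder (m + 1) α Ω) {x : EuclideanSpace ℝ (Fin n)} (hx : x ∈ Ω) :
    HasFDerivAt (zeroExt f)
      (∑ i, zeroExt (derivL i f) x • EuclideanSpace.proj (𝕜 := ℝ) i) x := by
  have hf1 : ContDiffOn ℝ (m + 1 : ℕ) (zeroExt f) Ω := f.mem.1.1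
  have hd : DifferentiableAt ℝ (zeroExt f) x :=
    (hf1.contDiffAt (Ω.isOpen.mem_nhds hx)).differentiableAt (by simp)
  convert hd.hasFDerivAt using 1
  rw [fderiv_eq_sum_pd]
  refine Finset.sum_congr rfl fun i _ => ?_
  have e := (isClosureDeriv_closureDeriv f.mem.1 (Pi.single i 1) (by simp)).eqOn_pd
    (hf1.of_le (by simp)) hx
  exact congrArg (· • _) e

/-- A function whose gradient has components in `C^{m,α}(cl Ω)` belongs to `C^{m+1,α}(cl Ω)`. -/
lemma exists_of_hasFDerivAt (f : closure (Ω : Set (EuclideanSpace ℝ (Fin n))) →ᵇ ℝ)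
    (g : Fin n → Schauder m α Ω)
    (h : ∀ x ∈ Ω, HasFDerivAt (zeroExt f)
      (∑ i, zeroExt (g i) x • EuclideanSpace.proj (𝕜 := ℝ) i) x) :
    ∃ F : Schauder (m + 1) α Ω, F.toBCF = f ∧ ∀ i, derivL i F = g i := by
  obtain ⟨h1, h2⟩ := mem_cm_succ (g := fun i => (g i).toBCF) (fun i => (g i).mem.1) h
  refine ⟨⟨f, h1, fun β hβ => ?_⟩, rfl, fun i => Subtype.ext (h2 i)⟩
  obtain ⟨i, β', hβ', rfl⟩ := exists_eq_add_single hβ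
  rw [← (closureDeriv_single_mem_cm h1 i).2 β' hβ'.le, h2]
  exact (g i).mem.2 β' hβ'

end Schauder

end

/-! ### Lipschitz estimate on a domain of class `C¹` -/

section

variable {n : ℕ}

/-- Near a boundary point, a chart turns the segment between two image points in the half space
into a curve in `Ω` of length comparable to the distance of the end points; hence the local
Lipschitz estimate in terms of a bound of the gradient, with a constant independent of the
function. -/
lemma exists_local_lipschitz {Ω : Set (EuclideanSpace ℝ (Fin n))} (ho : IsOpen Ω)
    (hΩ : IsOfClass 1 Ω) {p : EuclideanSpace ℝ (Fin n)} (hp : p ∈ closure Ω) :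
    ∃ U ∈ nhds p, ∃ K : ℝ, 0 ≤ K ∧ ∀ (F : EuclideanSpace ℝ (Fin n) → ℝ) (M : ℝ), 0 ≤ M →
      (∀ x ∈ Ω, DifferentiableAt ℝ F x ∧ ‖fderiv ℝ F x‖ ≤ M) →
      ∀ x ∈ U ∩ Ω, ∀ y ∈ U ∩ Ω, |F x - F y| ≤ K * M * ‖x - y‖ := by
  by_cases hpΩ : p ∈ Ω
  · obtain ⟨r, hr, hrΩ⟩ := Metric.isOpen_iff.1 ho p hpΩ
    refine ⟨Metric.ball p r, Metric.ball_mem_nhds p hr, 1, zero_le_one, ?_⟩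
    intro F M _ hF x hx y hy
    rw [one_mul]
    exact (convex_ball p r).norm_image_sub_le_of_norm_fderiv_le (𝕜 := ℝ)
      (fun z hz => (hF z (hrΩ hz)).1) (fun z hz => (hF z (hrΩ hz)).2) hy.1 hx.1
  · have hfr : p ∈ frontier Ω := ⟨hp, by rwa [ho.interior_eq]⟩
    obtain ⟨ψ, i, hps, h1, h2, hΩψ, -⟩ := hΩ p hfr
    have hq : ψ p ∈ ψ.target := ψ.map_source hps
    obtain ⟨K₁, t₁, ht₁, hK₁⟩ :=
      (h1.contDiffAt (ψ.open_source.mem_nhds hps)).exists_lipschitzOnWith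
    obtain ⟨K₂, t₂, ht₂, hK₂⟩ :=
      (h2.contDiffAt (ψ.open_target.mem_nhds hq)).exists_lipschitzOnWith
    obtain ⟨ε, hε, hεt⟩ := Metric.mem_nhds_iff.1
      (Filter.inter_mem ht₂ (ψ.open_target.mem_nhds hq))
    refine ⟨t₁ ∩ (ψ.source ∩ ψ ⁻¹' Metric.ball (ψ p) ε), Filter.inter_mem ht₁ (Filter.inter_mem
      (ψ.open_source.mem_nhds hps)
      ((ψ.continuousAt hps).preimage_mem_nhds (Metric.ball_mem_nhds _ hε))), K₂ * K₁,
      by positivity, ?_⟩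
    rintro F M hM hF x ⟨⟨hx1, hxs, hxb⟩, hxΩ⟩ y ⟨⟨hy1, hys, hyb⟩, hyΩ⟩
    -- the part of a ball around `ψ p` in the open half space: convex, and mapped into `Ω`
    set D : Set (EuclideanSpace ℝ (Fin n)) := Metric.ball (ψ p) ε ∩ {z | 0 < z i} with hD
    have hDc : Convex ℝ D := by
      refine (convex_ball _ _).inter ?_
      exact convex_halfSpace_gt (f := fun z : EuclideanSpace ℝ (Fin n) => z i)
        ⟨fun _ _ => rfl, fun _ _ => rfl⟩ 0
    have hDt : ∀ z ∈ D, z ∈ ψ.target := fun z hz => (hεt hz.1).2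
    have hDΩ : ∀ z ∈ D, ψ.symm z ∈ Ω := fun z hz => by
      rw [hΩψ _ (ψ.map_target (hDt z hz)), ψ.right_inv (hDt z hz)]
      exact hz.2
    have hdiff : ∀ z ∈ D, DifferentiableAt ℝ ψ.symm z := fun z hz =>
      (h2.contDiffAt (ψ.open_target.mem_nhds (hDt z hz))).differentiableAt (by simp)
    have hder : ∀ z ∈ D, ‖fderiv ℝ ψ.symm z‖ ≤ K₂ := fun z hz =>
      norm_fderiv_le_of_lipschitzOn ℝ (Filter.mem_of_superset (Metric.isOpen_ball.mem_nhds hz.1)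
        fun w hw => (hεt hw).1) hK₂
    have key := hDc.norm_image_sub_le_of_norm_fderiv_le (𝕜 := ℝ) (f := F ∘ ψ.symm) (C := M * K₂)
      (x := ψ y) (y := ψ x)
      (fun z hz => (hF _ (hDΩ z hz)).1.comp z (hdiff z hz))
      (fun z hz => by
        rw [fderiv_comp z (hF _ (hDΩ z hz)).1 (hdiff z hz)]
        exact (ContinuousLinearMap.opNorm_comp_le _ _).trans
          (mul_le_mul (hF _ (hDΩ z hz)).2 (hder z hz) (norm_nonneg _) hM))
      ⟨hyb, (hΩψ y hys).1 hyΩ⟩ ⟨hxb, (hΩψ x hxs).1 hxΩ⟩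
    simp only [Function.comp_apply, ψ.left_inv hxs, ψ.left_inv hys] at key
    calc |F x - F y| ≤ M * K₂ * ‖ψ x - ψ y‖ := key
      _ ≤ M * K₂ * (K₁ * ‖x - y‖) := by
        gcongr
        exact hK₁.norm_sub_le hx1 hy1
      _ = K₂ * K₁ * M * ‖x - y‖ := by ring

/-- A function with bounded gradient on a bounded domain of class `C¹` is Lipschitz, and its
Lipschitz constant is controlled by the suprema of the function and of its gradient. -/
lemma exists_lipschitz_const {Ω : Set (EuclideanSpace ℝ (Fin n))} (ho : IsOpen Ω)
    (hb : Bornology.IsBounded Ω) (hΩ : IsOfClass 1 Ω) :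
    ∃ C : ℝ, 0 ≤ C ∧ ∀ (F : EuclideanSpace ℝ (Fin n) → ℝ) (A M : ℝ), 0 ≤ M →
      (∀ x ∈ Ω, DifferentiableAt ℝ F x ∧ ‖fderiv ℝ F x‖ ≤ M) → (∀ x ∈ Ω, |F x| ≤ A) →
      ∀ x ∈ Ω, ∀ y ∈ Ω, |F x - F y| ≤ C * (A + M) * ‖x - y‖ := by
  have hloc : ∃ K : ℝ, 0 ≤ K ∧ ∃ δ : ℝ, 0 < δ ∧ ∀ (F : EuclideanSpace ℝ (Fin n) → ℝ) (M : ℝ),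
      0 ≤ M → (∀ x ∈ Ω, DifferentiableAt ℝ F x ∧ ‖fderiv ℝ F x‖ ≤ M) →
      ∀ x ∈ closure Ω, x ∈ Ω → ∀ y ∈ Ω, ‖x - y‖ < δ → |F x - F y| ≤ K * M * ‖x - y‖ := by
    refine hb.isCompact_closure.induction_on (p := fun s => ∃ K : ℝ, 0 ≤ K ∧ ∃ δ : ℝ, 0 < δ ∧
      ∀ (F : EuclideanSpace ℝ (Fin n) → ℝ) (M : ℝ),
      0 ≤ M → (∀ x ∈ Ω, DifferentiableAt ℝ F x ∧ ‖fderiv ℝ F x‖ ≤ M) →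
      ∀ x ∈ s, x ∈ Ω → ∀ y ∈ Ω, ‖x - y‖ < δ → |F x - F y| ≤ K * M * ‖x - y‖) ?_ ?_ ?_ ?_
    · exact ⟨0, le_rfl, 1, one_pos, by simp⟩
    · rintro s t hst ⟨K, hK, δ, hδ, H⟩
      exact ⟨K, hK, δ, hδ, fun F M hM hF x hx => H F M hM hF x (hst hx)⟩
    · rintro s t ⟨K, hK, δ, hδ, H⟩ ⟨K', hK', δ', hδ', H'⟩
      refine ⟨max K K', le_max_of_le_left hK, min δ δ', lt_min hδ hδ', ?_⟩
      rintro F M hM hF x (hx | hx) hxΩ y hy hxy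
      · refine (H F M hM hF x hx hxΩ y hy (hxy.trans_le (min_le_left _ _))).trans ?_
        gcongr
        exact le_max_left _ _
      · refine (H' F M hM hF x hx hxΩ y hy (hxy.trans_le (min_le_right _ _))).trans ?_
        gcongr
        exact le_max_right _ _
    · intro p hp
      obtain ⟨U, hU, K, hK, H⟩ := exists_local_lipschitz ho hΩ hp
      obtain ⟨r, hr, hrU⟩ := Metric.mem_nhds_iff.1 hU
      refine ⟨Metric.ball p (r / 2), mem_nhdsWithin_of_mem_nhds (Metric.ball_mem_nhds _ (by linarith)),
        K, hK, r / 2, by linarith, ?_⟩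
      intro F M hM hF x hx hxΩ y hy hxy
      rw [Metric.mem_ball] at hx
      refine H F M hM hF x ⟨hrU ?_, hxΩ⟩ y ⟨hrU ?_, hy⟩
      · rw [Metric.mem_ball]
        linarith
      · rw [Metric.mem_ball]
        rw [← dist_eq_norm, dist_comm] at hxy
        linarith [dist_triangle y x p]
  obtain ⟨K, hK, δ, hδ, H⟩ := hloc
  refine ⟨K + 2 / δ, by positivity, ?_⟩
  intro F A M hM hF hA x hx y hy
  have hA0 : 0 ≤ A := (abs_nonneg _).trans (hA x hx)
  rcases lt_or_ge ‖x - y‖ δ with h | h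
  · refine (H F M hM hF x (subset_closure hx) hx y hy h).trans ?_
    have h1 : K * M ≤ (K + 2 / δ) * (A + M) :=
      mul_le_mul (le_add_of_nonneg_right (by positivity)) (by linarith) hM (by positivity)
    gcongr
  · calc |F x - F y| ≤ |F x| + |F y| := abs_sub _ _
      _ ≤ 2 / δ * A * δ := by
        have := hA x hx
        have := hA y hy
        field_simp
        linarith
      _ ≤ (K + 2 / δ) * (A + M) * ‖x - y‖ := by
        have h1 : 2 / δ * A ≤ (K + 2 / δ) * (A + M) :=
          mul_le_mul (by linarith) (by linarith) hA0 (by positivity)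
        gcongr

variable {Ω : Opens (EuclideanSpace ℝ (Fin n))} {m : ℕ} {α : ℝ≥0}

lemma denseRange_inclusion_closure (Ω : Opens (EuclideanSpace ℝ (Fin n))) :
    DenseRange (Set.inclusion (subset_closure : (Ω : Set (EuclideanSpace ℝ (Fin n))) ⊆ closure Ω)) :=
  (denseRange_inclusion_iff subset_closure).2 le_rfl

namespace Schauder

/-- Functions of class `C^{m+1,α}` on the closure of a `C¹` domain are Lipschitz. -/
lemma exists_lipschitz_bound (hb : Bornology.IsBounded (Ω : Set (EuclideanSpace ℝ (Fin n))))
    (hΩ : IsOfClass 1 (Ω : Set (EuclideanSpace ℝ (Fin n)))) :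
    ∃ C : ℝ, 0 ≤ C ∧ ∀ (m : ℕ) (α : ℝ≥0) (f : Schauder (m + 1) α Ω) x y,
      |f x - f y| ≤ C * ‖f‖ * dist x y := by
  obtain ⟨C, hC, H⟩ := exists_lipschitz_const Ω.isOpen hb hΩ
  refine ⟨C * (1 + n), by positivity, ?_⟩
  intro m α f x y
  refine (denseRange_inclusion_closure Ω).induction_on₂
    (p := fun x y => |f x - f y| ≤ C * (1 + n) * ‖f‖ * dist x y) ?_ ?_ x y
  · have hf : Continuous f := f.toBCF.continuous
    exact isClosed_le (by fun_prop) (by fun_prop)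
  · rintro ⟨x, hx⟩ ⟨y, hy⟩
    have h := H (zeroExt f) ‖f‖ (n * ‖f‖) (by positivity) (fun z hz => ?_) (fun z hz => ?_) x hx y hy
    · rw [zeroExt_of_mem _ hx, zeroExt_of_mem _ hy] at h
      refine h.trans (le_of_eq ?_)
      rw [Subtype.dist_eq, dist_eq_norm]
      simp only
      ring
    · refine ⟨(f.hasFDerivAt hz).differentiableAt, ?_⟩
      rw [(f.hasFDerivAt hz).fderiv]
      refine (norm_sum_smul_proj_le _).trans ?_
      calc _ ≤ ∑ i : Fin n, ‖f‖ := Finset.sum_le_sum fun i _ => by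
            rw [zeroExt_of_mem _ hz]
            exact (norm_apply_le _ _).trans (norm_derivL_le i f)
        _ = n * ‖f‖ := by simp
    · rw [zeroExt_of_mem _ hz]
      exact norm_apply_le _ _

end Schauder

end

/-! ### The Schauder space is complete -/

section

variable {n : ℕ} {Ω : Opens (EuclideanSpace ℝ (Fin n))} {m : ℕ} {α : ℝ≥0}

namespace Schauder

/-- A bounded Hölder continuous function as an element of `C^{0,α}(cl Ω)`. -/
lemma exists_of_abs_sub_le (f : closure (Ω : Set (EuclideanSpace ℝ (Fin n))) →ᵇ ℝ) {K : ℝ}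
    (hK : 0 ≤ K) (h : ∀ x y, |f x - f y| ≤ K * dist x y ^ (α : ℝ)) :
    ∃ F : Schauder 0 α Ω, F.toBCF = f ∧ ‖F‖ ≤ ‖f‖ + K := by
  lift K to ℝ≥0 using hK
  have hf : HolderWith K α f := fun x y => by
    rw [edist_nndist, edist_nndist, ← ENNReal.coe_rpow_of_nonneg _ α.coe_nonneg, ← ENNReal.coe_mul,
      ENNReal.coe_le_coe, ← NNReal.coe_le_coe]
    simpa [Real.dist_eq] using h x y
  obtain ⟨F, rfl⟩ := exists_of_memHolder f hf.memHolder
  refine ⟨F, rfl, ?_⟩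
  rw [norm_zero_eq]
  gcongr
  exact hf.nnholderNorm_le

lemma abs_sub_le (f : Schauder 0 α Ω) (x y) : |f x - f y| ≤ ‖f‖ * dist x y ^ (α : ℝ) := by
  have h := f.memHolder_zero.holderWith.dist_le x y
  rw [Real.dist_eq] at h
  refine h.trans ?_
  gcongr
  rw [norm_zero_eq]
  exact le_add_of_nonneg_left (norm_nonneg _)

lemma cauchySeq_toBCF {u : ℕ → Schauder m α Ω} (hu : CauchySeq u) :
    CauchySeq fun k => (u k).toBCF := by
  rw [Metric.cauchySeq_iff] at hu ⊢
  intro ε hε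
  obtain ⟨N, hN⟩ := hu ε hε
  refine ⟨N, fun k hk l hl => lt_of_le_of_lt ?_ (hN k hk l hl)⟩
  rw [dist_eq_norm, dist_eq_norm]
  exact norm_toBCF_le (u k - u l)

/-- Hölder estimates pass to the pointwise limit. -/
lemma complete_zero : CompleteSpace (Schauder 0 α Ω) := by
  refine Metric.complete_of_cauchySeq_tendsto fun u hu => ?_
  obtain ⟨f, hf⟩ := cauchySeq_tendsto_of_complete (cauchySeq_toBCF hu)
  have hpt : ∀ x, Filter.Tendsto (fun k => u k x) Filter.atTop (nhds (f x)) := fun x =>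
    ((continuous_eval_const x).tendsto f).comp hf
  have key : ∀ ε > 0, ∃ N, ∀ k ≥ N, ∀ x y,
      |(f - (u k).toBCF) x - (f - (u k).toBCF) y| ≤ ε * dist x y ^ (α : ℝ) := by
    intro ε hε
    obtain ⟨N, hN⟩ := Metric.cauchySeq_iff.1 hu ε hε
    refine ⟨N, fun k hk x y => ?_⟩
    have hlim : Filter.Tendsto (fun l => |(u l - u k) x - (u l - u k) y|) Filter.atTop
        (nhds |(f x - u k x) - (f y - u k y)|) :=
      (((hpt x).sub_const _).sub ((hpt y).sub_const _)).abs
    refine le_of_tendsto hlim ?_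
    filter_upwards [Filter.eventually_ge_atTop N] with l hl
    refine (abs_sub_le (u l - u k) x y).trans ?_
    gcongr
    rw [← dist_eq_norm]
    exact (hN l hl k hk).le
  obtain ⟨N, hN⟩ := key 1 one_pos
  obtain ⟨G, hG, -⟩ := exists_of_abs_sub_le _ zero_le_one (hN N le_rfl)
  refine ⟨G + u N, ?_⟩
  have hF : (G + u N).toBCF = f := by
    change G.toBCF + (u N).toBCF = f
    rw [hG, sub_add_cancel]
  rw [Metric.tendsto_atTop]
  intro ε hε
  obtain ⟨N₁, hN₁⟩ := key (ε / 3) (by positivity)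
  obtain ⟨N₂, hN₂⟩ := Metric.tendsto_atTop.1 hf (ε / 3) (by positivity)
  refine ⟨max N₁ N₂, fun k hk => ?_⟩
  obtain ⟨H, hH, hHn⟩ := exists_of_abs_sub_le _ (by positivity : (0 : ℝ) ≤ ε / 3)
    (hN₁ k (le_of_max_le_left hk))
  have e : H = G + u N - u k := Subtype.ext (hH.trans (by rw [← hF]; rfl))
  have h2 := hN₂ k (le_of_max_le_right hk)
  rw [dist_comm, dist_eq_norm] at h2
  rw [dist_comm, dist_eq_norm, ← e]
  linarith

/-- The gradients of a Cauchy sequence converge in the space of order `m`, and their uniform limit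
is the gradient of the uniform limit of the sequence. -/
lemma complete_succ [CompleteSpace (Schauder m α Ω)] : CompleteSpace (Schauder (m + 1) α Ω) := by
  refine Metric.complete_of_cauchySeq_tendsto fun u hu => ?_
  obtain ⟨f, hf⟩ := cauchySeq_tendsto_of_complete (cauchySeq_toBCF hu)
  have hd : ∀ i, ∃ g : Schauder m α Ω,
      Filter.Tendsto (fun k => derivL i (u k)) Filter.atTop (nhds g) := fun i =>
    cauchySeq_tendsto_of_complete ((derivL i).uniformContinuous.comp_cauchySeq hu)
  choose g hg using hd
  have hg' : Filter.Tendsto (fun k => ∑ i, ‖derivL i (u k) - g i‖) Filter.atTop (nhds 0) := by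
    have := tendsto_finsetSum Finset.univ fun i _ => ((hg i).sub_const (g i)).norm
    simpa using this
  obtain ⟨F, hF, hFd⟩ := exists_of_hasFDerivAt f g fun x hx => by
    refine hasFDerivAt_of_tendstoUniformlyOn (l := Filter.atTop) (f := fun k => zeroExt (u k))
      (g' := fun x => ∑ i, zeroExt (g i) x •
        (EuclideanSpace.proj (𝕜 := ℝ) i : EuclideanSpace ℝ (Fin n) →L[ℝ] ℝ))
      Ω.isOpen ?_ (fun k x hx => (u k).hasFDerivAt hx) (fun x hx => ?_) hx
    · rw [Metric.tendstoUniformlyOn_iff]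
      intro ε hε
      filter_upwards [hg'.eventually (gt_mem_nhds hε)] with k hk x hx
      refine lt_of_le_of_lt ?_ hk
      rw [dist_comm, dist_eq_norm, ← Finset.sum_sub_distrib]
      simp only [← sub_smul]
      refine (norm_sum_smul_proj_le _).trans (Finset.sum_le_sum fun i _ => ?_)
      rw [zeroExt_of_mem _ hx, zeroExt_of_mem _ hx]
      exact norm_apply_le (derivL i (u k) - g i) _
    · rw [zeroExt_of_mem _ hx]
      simp only [zeroExt_of_mem _ hx]
      exact ((continuous_eval_const (⟨x, subset_closure hx⟩ :
        closure (Ω : Set (EuclideanSpace ℝ (Fin n))))).tendsto f).comp hf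
  refine ⟨F, ?_⟩
  rw [tendsto_iff_norm_sub_tendsto_zero]
  have h1 : Filter.Tendsto (fun k => ‖(u k).toBCF - f‖) Filter.atTop (nhds 0) :=
    tendsto_iff_norm_sub_tendsto_zero.1 hf
  refine squeeze_zero (fun _ => norm_nonneg _) (fun k => ?_) (by simpa using h1.add hg')
  refine (norm_succ_le _).trans (le_of_eq ?_)
  simp only [map_sub, hFd]
  rw [← hF]
  rfl

instance : CompleteSpace (Schauder m α Ω) := by
  induction m with
  | zero => exact complete_zero
  | succ m ih => exact complete_succ

/-! ### The Schauder space is an algebra -/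

lemma dist_le_mul_rpow (hb : Bornology.IsBounded (Ω : Set (EuclideanSpace ℝ (Fin n))))
    (hα : α ≤ 1) : ∃ D : ℝ, 0 ≤ D ∧ ∀ x y : closure (Ω : Set (EuclideanSpace ℝ (Fin n))),
      dist x y ≤ D * dist x y ^ (α : ℝ) := by
  set d := Metric.diam (closure (Ω : Set (EuclideanSpace ℝ (Fin n))))
  have h1 : (0 : ℝ) ≤ 1 - α := sub_nonneg.2 (by exact_mod_cast hα)
  refine ⟨d ^ (1 - α : ℝ), Real.rpow_nonneg Metric.diam_nonneg _, fun x y => ?_⟩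
  rcases eq_or_lt_of_le (dist_nonneg (x := x) (y := y)) with h | h
  · rw [← h]
    have : (0 : ℝ) ≤ d := Metric.diam_nonneg
    positivity
  · calc dist x y = dist x y ^ (1 - α : ℝ) * dist x y ^ (α : ℝ) := by
          rw [← Real.rpow_add h]
          simp
      _ ≤ _ := by
          gcongr
          exact Metric.dist_le_diam_of_mem hb.closure x.2 y.2

/-- The space `C^{m+1,α}(cl Ω)` embeds in `C^{m,α}(cl Ω)`. -/
lemma exists_inclusion (hb : Bornology.IsBounded (Ω : Set (EuclideanSpace ℝ (Fin n))))
    (hΩ : IsOfClass 1 (Ω : Set (EuclideanSpace ℝ (Fin n)))) (hα : α ≤ 1) (m : ℕ) :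
    ∃ C : ℝ, 0 ≤ C ∧ ∀ f : Schauder (m + 1) α Ω, ∃ g : Schauder m α Ω,
      g.toBCF = f.toBCF ∧ ‖g‖ ≤ C * ‖f‖ := by
  induction m with
  | zero =>
    obtain ⟨C, hC, H⟩ := exists_lipschitz_bound hb hΩ
    obtain ⟨D, hD, hD'⟩ := dist_le_mul_rpow (α := α) hb hα
    refine ⟨1 + C * D, by positivity, fun f => ?_⟩
    obtain ⟨g, hg, hgn⟩ := exists_of_abs_sub_le (α := α) f.toBCF
      (by positivity : 0 ≤ C * ‖f‖ * D) fun x y => by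
      refine (H 0 α f x y).trans ?_
      rw [mul_assoc (C * ‖f‖)]
      exact mul_le_mul_of_nonneg_left (hD' x y) (by positivity)
    refine ⟨g, hg, hgn.trans ?_⟩
    have := f.norm_toBCF_le
    linarith
  | succ m ih =>
    obtain ⟨C, hC, H⟩ := ih
    refine ⟨1 + n * C, by positivity, fun f => ?_⟩
    choose g hg hgn using fun i => H (derivL i f)
    obtain ⟨F, hF, hFd⟩ := exists_of_hasFDerivAt f.toBCF g fun x hx => by
      simp only [← coe_toBCF, hg]
      exact f.hasFDerivAt hx
    refine ⟨F, hF, (norm_succ_le F).trans ?_⟩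
    rw [hF, add_mul, one_mul]
    refine add_le_add f.norm_toBCF_le ?_
    calc ∑ i, ‖derivL i F‖ ≤ ∑ i : Fin n, C * ‖f‖ := Finset.sum_le_sum fun i _ => by
          rw [hFd]
          exact (hgn i).trans (by gcongr; exact norm_derivL_le i f)
      _ = n * C * ‖f‖ := by simp [mul_assoc]

lemma zeroExt_mul (f g : closure (Ω : Set (EuclideanSpace ℝ (Fin n))) →ᵇ ℝ)
    (x : EuclideanSpace ℝ (Fin n)) (hx : x ∈ Ω) :
    zeroExt (f * g) x = zeroExt f x * zeroExt g x := by
  rw [zeroExt_of_mem _ hx, zeroExt_of_mem _ hx, zeroExt_of_mem _ hx]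
  rfl

/-- By induction on `m`, from `∂ᵢ(f g) = f ∂ᵢg + ∂ᵢf g`, where `f` and `g` are taken to the space of
order `m` by the embedding. -/
lemma exists_mul_bound (hb : Bornology.IsBounded (Ω : Set (EuclideanSpace ℝ (Fin n))))
    (hΩ : IsOfClass 1 (Ω : Set (EuclideanSpace ℝ (Fin n)))) (hα : α ≤ 1) (m : ℕ) :
    ∃ C : ℝ, 0 ≤ C ∧ ∀ f g : Schauder m α Ω, ∃ p : Schauder m α Ω,
      p.toBCF = f.toBCF * g.toBCF ∧ ‖p‖ ≤ C * (‖f‖ * ‖g‖) := by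
  induction m with
  | zero =>
    refine ⟨3, by norm_num, fun f g => ?_⟩
    obtain ⟨p, hp, hpn⟩ := exists_of_abs_sub_le (α := α) (f.toBCF * g.toBCF)
      (by positivity : 0 ≤ 2 * (‖f‖ * ‖g‖)) fun x y => by
      have e : f x * g x - f y * g y = f x * (g x - g y) + (f x - f y) * g y := by ring
      change |f x * g x - f y * g y| ≤ _
      rw [e]
      refine (abs_add_le _ _).trans ?_
      rw [abs_mul, abs_mul]
      have h1 : |f x| * |g x - g y| ≤ ‖f‖ * (‖g‖ * dist x y ^ (α : ℝ)) :=
        mul_le_mul (norm_apply_le f x) (abs_sub_le g x y) (abs_nonneg _) (norm_nonneg _)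
      have h2 : |f x - f y| * |g y| ≤ (‖f‖ * dist x y ^ (α : ℝ)) * ‖g‖ :=
        mul_le_mul (abs_sub_le f x y) (norm_apply_le g y) (abs_nonneg _) (by positivity)
      linarith
    refine ⟨p, hp, hpn.trans ?_⟩
    have h : ‖f.toBCF * g.toBCF‖ ≤ ‖f‖ * ‖g‖ := (norm_mul_le _ _).trans
      (mul_le_mul f.norm_toBCF_le g.norm_toBCF_le (norm_nonneg _) (norm_nonneg _))
    linarith
  | succ m ih =>
    obtain ⟨C, hC, H⟩ := ih
    obtain ⟨c, hc, J⟩ := exists_inclusion hb hΩ hα m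
    choose P hP hPn using H
    choose ι hι hιn using J
    have hP' : ∀ f g x, P f g x = f x * g x := fun f g x => by
      rw [← coe_toBCF, hP]
      rfl
    have hι' : ∀ f x, ι f x = f x := fun f x => by
      rw [← coe_toBCF, hι]
      rfl
    refine ⟨1 + n * (2 * C * c), by positivity, fun f g => ?_⟩
    have hder : ∀ x ∈ Ω, HasFDerivAt (zeroExt (f.toBCF * g.toBCF))
        (∑ i, zeroExt (P (ι f) (derivL i g) + P (derivL i f) (ι g)) x •
          EuclideanSpace.proj (𝕜 := ℝ) i) x := fun x hx => by
      have h := (f.hasFDerivAt hx).mul (g.hasFDerivAt hx)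
      have h' := h.congr_of_eventuallyEq (f₁ := zeroExt (f.toBCF * g.toBCF)) (by
        filter_upwards [Ω.isOpen.mem_nhds hx] with y hy
        exact zeroExt_mul _ _ y hy)
      refine h'.congr_fderiv ?_
      rw [Finset.smul_sum, Finset.smul_sum, ← Finset.sum_add_distrib]
      refine Finset.sum_congr rfl fun i _ => ?_
      rw [smul_smul, smul_smul, ← add_smul]
      congr 1
      simp only [zeroExt_of_mem _ hx, add_apply, hP', hι']
      ring
    obtain ⟨F, hF, hFd⟩ := exists_of_hasFDerivAt (f.toBCF * g.toBCF)
      (fun i => P (ι f) (derivL i g) + P (derivL i f) (ι g)) hder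
    refine ⟨F, hF, (norm_succ_le F).trans ?_⟩
    rw [hF, add_mul, one_mul]
    refine add_le_add ((norm_mul_le _ _).trans
      (mul_le_mul f.norm_toBCF_le g.norm_toBCF_le (norm_nonneg _) (norm_nonneg _))) ?_
    calc ∑ i, ‖derivL i F‖ ≤ ∑ i : Fin n, 2 * C * c * (‖f‖ * ‖g‖) :=
          Finset.sum_le_sum fun i _ => by
          rw [hFd]
          refine (norm_add_le _ _).trans ?_
          have h1 : ‖P (ι f) (derivL i g)‖ ≤ C * ((c * ‖f‖) * ‖g‖) := (hPn _ _).trans (by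
            gcongr
            · exact hιn f
            · exact norm_derivL_le i g)
          have h2 : ‖P (derivL i f) (ι g)‖ ≤ C * (‖f‖ * (c * ‖g‖)) := (hPn _ _).trans (by
            gcongr
            · exact norm_derivL_le i f
            · exact hιn g)
          linarith
      _ = n * (2 * C * c) * (‖f‖ * ‖g‖) := by simp [mul_assoc]

/-- On a bounded domain of class `C¹`, the pointwise product is a continuous bilinear operation of
the Schauder space. -/
lemma exists_mulL (hb : Bornology.IsBounded (Ω : Set (EuclideanSpace ℝ (Fin n))))
    (hΩ : IsOfClass 1 (Ω : Set (EuclideanSpace ℝ (Fin n)))) (hα : α ≤ 1) (m : ℕ) :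
    ∃ B : Schauder m α Ω →L[ℝ] Schauder m α Ω →L[ℝ] Schauder m α Ω,
      ∀ f g x, B f g x = f x * g x := by
  obtain ⟨C, hC, H⟩ := exists_mul_bound hb hΩ hα m
  choose P hP hPn using H
  have hP' : ∀ f g x, P f g x = f x * g x := fun f g x => by
    rw [← coe_toBCF, hP]
    rfl
  refine ⟨LinearMap.mkContinuous₂ (LinearMap.mk₂ ℝ P (fun f f' g => ext fun x => ?_)
    (fun c f g => ext fun x => ?_) (fun f g g' => ext fun x => ?_) fun c f g => ext fun x => ?_) C
    fun f g => by simpa [mul_assoc] using hPn f g, hP'⟩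
  all_goals
    simp only [hP', add_apply, smul_apply]
    ring

end Schauder

end

/-! ### The set `C^{m,α}(cl Ω, D)` -/

section

variable {n r : ℕ} {Ω : Opens (EuclideanSpace ℝ (Fin n))} {D : Opens (EuclideanSpace ℝ (Fin r))}
  {m : ℕ} {α : ℝ≥0}

lemma euclidean_norm_le_sum (z : EuclideanSpace ℝ (Fin r)) : ‖z‖ ≤ ∑ i, |z i| := by
  have hz : z = ∑ i, z i • EuclideanSpace.single i (1 : ℝ) := by
    simpa using ((EuclideanSpace.basisFun (Fin r) ℝ).sum_repr z).symm
  conv_lhs => rw [hz]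
  refine (norm_sum_le _ _).trans (le_of_eq (Finset.sum_congr rfl fun i _ => ?_))
  simp [norm_smul]

namespace Schauder

lemma continuous_eval (v : Fin r → Schauder m α Ω) : Continuous (eval v) :=
  (PiLp.continuous_toLp 2 _).comp (continuous_pi fun i => (v i).toBCF.continuous)

lemma norm_eval_le (v : Fin r → Schauder m α Ω) (x) : ‖eval v x‖ ≤ r * ‖v‖ := by
  refine (euclidean_norm_le_sum _).trans ?_
  calc ∑ i, |eval v x i| ≤ ∑ i : Fin r, ‖v‖ := Finset.sum_le_sum fun i _ =>
        (norm_apply_le (v i) x).trans (norm_le_pi_norm v i)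
    _ = r * ‖v‖ := by simp

lemma eval_add (v w : Fin r → Schauder m α Ω) (x) : eval (v + w) x = eval v x + eval w x := rfl

end Schauder

/-- The image of `cl Ω` under `v` is compact, hence at positive distance from the complement of `D`. -/
lemma exists_ball_subset (hb : Bornology.IsBounded (Ω : Set (EuclideanSpace ℝ (Fin n))))
    {v : Fin r → Schauder m α Ω} (hv : v ∈ schauderInto m α Ω (D : Set _)) :
    ∃ δ > 0, ∀ x, Metric.ball (Schauder.eval v x) δ ⊆ D := by
  have : CompactSpace (closure (Ω : Set (EuclideanSpace ℝ (Fin n)))) :=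
    isCompact_iff_compactSpace.1 hb.isCompact_closure
  obtain ⟨δ, hδ, h⟩ := (isCompact_range (Schauder.continuous_eval v)).exists_thickening_subset_open
    D.isOpen (by rintro _ ⟨x, rfl⟩; exact hv x)
  exact ⟨δ, hδ, fun x => (Metric.ball_subset_thickening (Set.mem_range_self x) δ).trans h⟩

lemma isOpen_schauderInto (hb : Bornology.IsBounded (Ω : Set (EuclideanSpace ℝ (Fin n)))) :
    IsOpen (schauderInto m α Ω (D : Set (EuclideanSpace ℝ (Fin r)))) := by
  rw [Metric.isOpen_iff]
  intro v hv
  obtain ⟨δ, hδ, h⟩ := exists_ball_subset hb hv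
  refine ⟨δ / (r + 1), by positivity, fun w hw x => h x ?_⟩
  rw [mem_ball_iff_norm, lt_div_iff₀ (by positivity)] at hw
  have e : Schauder.eval w x = Schauder.eval v x + Schauder.eval (w - v) x := by
    rw [← Schauder.eval_add, add_sub_cancel]
  rw [e, mem_ball_iff_norm, add_sub_cancel_left]
  refine (Schauder.norm_eval_le _ x).trans_lt (lt_of_le_of_lt ?_ hw)
  rw [mul_comm]
  gcongr
  linarith

/-! ### Composition with a smooth function -/

/-- A Lipschitz estimate at a point `a` at distance at least `δ` from the complement of `D`: nearby
points are joined to `a` by a segment in `D`, the other ones are at distance at least `δ`. -/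
lemma abs_sub_le_of_ball_subset {U : EuclideanSpace ℝ (Fin r) → ℝ} {M δ : ℝ} (hM : 0 ≤ M)
    (hδ : 0 < δ) (hU : ∀ y ∈ D, DifferentiableAt ℝ U y) (h0 : ∀ y ∈ D, |U y| ≤ M)
    (h1 : ∀ i, ∀ y ∈ D, |pd i U y| ≤ M) {a b : EuclideanSpace ℝ (Fin r)}
    (ha : Metric.ball a δ ⊆ D) (hb : b ∈ D) : |U b - U a| ≤ (r + 2 / δ) * M * ‖b - a‖ := by
  rcases lt_or_ge ‖b - a‖ δ with h | h
  · have h2 := (convex_ball a δ).norm_image_sub_le_of_norm_fderiv_le (𝕜 := ℝ) (f := U)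
      (C := r * M) (fun z hz => hU z (ha hz)) (fun z hz => by
        rw [fderiv_eq_sum_pd]
        refine (norm_sum_smul_proj_le _).trans ?_
        calc ∑ i, |pd i U z| ≤ ∑ i : Fin r, M := Finset.sum_le_sum fun i _ => h1 i z (ha hz)
          _ = r * M := by simp) (Metric.mem_ball_self hδ) (mem_ball_iff_norm.2 h)
    refine h2.trans ?_
    gcongr
    exact le_add_of_nonneg_right (by positivity)
  · have haD : a ∈ D := ha (Metric.mem_ball_self hδ)
    calc |U b - U a| ≤ |U b| + |U a| := abs_sub _ _
      _ ≤ 2 / δ * M * δ := by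
        have := h0 a haD
        have := h0 b hb
        field_simp
        linarith
      _ ≤ (r + 2 / δ) * M * ‖b - a‖ := by
        gcongr
        exact le_add_of_nonneg_left (by positivity)

lemma hasFDerivAt_comp_eval {U : EuclideanSpace ℝ (Fin r) → ℝ}
    {v : Fin r → Schauder (m + 1) α Ω} {x : EuclideanSpace ℝ (Fin n)} (hx : x ∈ Ω)
    (hU : DifferentiableAt ℝ U (Schauder.eval v ⟨x, subset_closure hx⟩))
    {f : closure (Ω : Set (EuclideanSpace ℝ (Fin n))) → ℝ}
    (hf : ∀ x, f x = U (Schauder.eval v x)) :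
    HasFDerivAt (zeroExt f)
      (∑ i, (∑ j, pd j U (Schauder.eval v ⟨x, subset_closure hx⟩) *
        Schauder.derivL i (v j) ⟨x, subset_closure hx⟩) • EuclideanSpace.proj (𝕜 := ℝ) i) x := by
  set V : EuclideanSpace ℝ (Fin n) → EuclideanSpace ℝ (Fin r) :=
    fun y => WithLp.toLp 2 fun j => zeroExt (v j) y with hVdef
  have hVe : ∀ y (hy : y ∈ Ω), V y = Schauder.eval v ⟨y, subset_closure hy⟩ := fun y hy => by
    simp only [hVdef, Schauder.eval, zeroExt_of_mem _ hy]
  have hVd : DifferentiableAt ℝ V x := by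
    rw [differentiableAt_euclidean]
    exact fun j => ((v j).hasFDerivAt hx).differentiableAt
  have hcomp := (show HasFDerivAt U _ (V x) from (by rw [hVe x hx]; exact hU.hasFDerivAt)).comp x
    hVd.hasFDerivAt
  refine (hcomp.congr_of_eventuallyEq ?_).congr_fderiv ?_
  · filter_upwards [Ω.isOpen.mem_nhds hx] with y hy
    rw [zeroExt_of_mem _ hy, hf, Function.comp_apply, hVe y hy]
  · rw [fderiv_eq_sum_pd]
    simp only [Finset.sum_smul]
    rw [Finset.sum_comm, ContinuousLinearMap.finsetSum_comp]
    refine Finset.sum_congr rfl fun j _ => ?_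
    have hj := ((EuclideanSpace.proj (𝕜 := ℝ) j).hasFDerivAt.comp x hVd.hasFDerivAt).unique
      ((v j).hasFDerivAt hx)
    rw [ContinuousLinearMap.smul_comp, hj, Finset.smul_sum]
    refine Finset.sum_congr rfl fun i _ => ?_
    rw [smul_smul, zeroExt_of_mem _ hx]

/-- The composition of a smooth function `U` with `v ∈ C^{m,α}(cl Ω, D)` is of class `C^{m,α}`,
and its norm is controlled by the derivatives of `U` of order at most `m + 1`, with a constant that
depends on `v` only. By induction on `m`, from the chain rule `∂ᵢ(U ∘ v) = ∑ⱼ (∂ⱼU ∘ v) ∂ᵢvⱼ`. -/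
lemma exists_comp (hb : Bornology.IsBounded (Ω : Set (EuclideanSpace ℝ (Fin n))))
    (hΩ : IsOfClass 1 (Ω : Set (EuclideanSpace ℝ (Fin n)))) (hα : α ≤ 1) (m : ℕ) :
    ∀ v ∈ schauderInto m α Ω (D : Set (EuclideanSpace ℝ (Fin r))), ∃ C : ℝ, 0 ≤ C ∧
      ∀ (U : EuclideanSpace ℝ (Fin r) → ℝ) (M : ℝ), 0 ≤ M → ContDiffOn ℝ (⊤ : ℕ∞) U D →
      (∀ w : List (Fin r), w.length ≤ m + 1 → ∀ y ∈ D, |wordD w U y| ≤ M) →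
      ∃ F : Schauder m α Ω, (∀ x, F x = U (Schauder.eval v x)) ∧ ‖F‖ ≤ C * M := by
  -- the composite as a bounded continuous function
  have hbcf : ∀ (m : ℕ), ∀ v ∈ schauderInto m α Ω (D : Set (EuclideanSpace ℝ (Fin r))),
      ∀ (U : EuclideanSpace ℝ (Fin r) → ℝ) (M : ℝ), 0 ≤ M → ContDiffOn ℝ (⊤ : ℕ∞) U D →
      (∀ y ∈ D, |U y| ≤ M) →
      ∃ f : closure (Ω : Set (EuclideanSpace ℝ (Fin n))) →ᵇ ℝ,
        (∀ x, f x = U (Schauder.eval v x)) ∧ ‖f‖ ≤ M := fun m v hv U M hM hU h0 =>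
    ⟨BoundedContinuousFunction.ofNormedAddCommGroup (fun x => U (Schauder.eval v x))
      (hU.continuousOn.comp_continuous (Schauder.continuous_eval v) hv) M fun x => h0 _ (hv x),
      fun x => rfl, BoundedContinuousFunction.norm_ofNormedAddCommGroup_le _ hM _⟩
  have hUd : ∀ {U : EuclideanSpace ℝ (Fin r) → ℝ}, ContDiffOn ℝ (⊤ : ℕ∞) U D →
      ∀ y ∈ D, DifferentiableAt ℝ U y := fun hU y hy =>
    (hU.contDiffAt (D.isOpen.mem_nhds hy)).differentiableAt (by simp)
  induction m with
  | zero =>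
    intro v hv
    obtain ⟨δ, hδ, hball⟩ := exists_ball_subset hb hv
    refine ⟨1 + (r + 2 / δ) * ∑ i, ‖v i‖, by positivity, fun U M hM hU hw => ?_⟩
    have h0 := hw [] (by simp)
    obtain ⟨f, hf, hfn⟩ := hbcf 0 v hv U M hM hU h0
    obtain ⟨F, rfl, hFn⟩ := Schauder.exists_of_abs_sub_le (α := α) f
      (by positivity : 0 ≤ (r + 2 / δ) * M * ∑ i, ‖v i‖) fun x y => by
      rw [hf, hf]
      refine (abs_sub_le_of_ball_subset hM hδ (hUd hU) h0 (fun i => hw [i] (by simp))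
        (hball y) (hv x)).trans ?_
      rw [mul_assoc _ (∑ i, ‖v i‖), Finset.sum_mul]
      gcongr
      refine (euclidean_norm_le_sum _).trans (Finset.sum_le_sum fun i _ => ?_)
      exact Schauder.abs_sub_le (v i) x y
    refine ⟨F, hf, hFn.trans ?_⟩
    linarith
  | succ m ih =>
    intro v hv
    obtain ⟨c, hc, J⟩ := Schauder.exists_inclusion hb hΩ hα m
    obtain ⟨B, hB⟩ := Schauder.exists_mulL hb hΩ hα m
    choose ι hι _ using J
    have he : Schauder.eval (fun i => ι (v i)) = Schauder.eval v := by
      funext x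
      simp only [Schauder.eval, ← Schauder.coe_toBCF, hι]
    obtain ⟨C, hC, H⟩ := ih (fun i => ι (v i)) (fun x => by rw [he]; exact hv x)
    rw [he] at H
    refine ⟨1 + n * ∑ j, ‖B‖ * C * ‖v j‖, by positivity, fun U M hM hU hw => ?_⟩
    obtain ⟨f, hf, hfn⟩ := hbcf _ v hv U M hM hU (hw [] (by simp))
    choose P hP hPn using fun j => H (pd j U) M hM (contDiffOn_pd D.isOpen hU le_rfl j)
      fun w hwl y hy => by
        have := hw (w ++ [j]) (by simpa using hwl) y hy
        rwa [wordD_append] at this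
    obtain ⟨F, rfl, hFd⟩ := Schauder.exists_of_hasFDerivAt f
      (fun i => ∑ j, B (P j) (Schauder.derivL i (v j))) fun x hx => by
        refine (hasFDerivAt_comp_eval hx (hUd hU _ (hv _)) hf).congr_fderiv ?_
        refine Finset.sum_congr rfl fun i _ => ?_
        congr 1
        have hsum : ∀ (s : Fin r → Schauder m α Ω) (x), (∑ j, s j) x = ∑ j, s j x := fun s x =>
          map_sum (AddMonoidHom.mk' (fun f : Schauder m α Ω => f x) fun _ _ => rfl) s _
        rw [zeroExt_of_mem _ hx, hsum]
        simp only [hB, hP]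
    refine ⟨F, hf, (Schauder.norm_succ_le F).trans ?_⟩
    rw [add_mul, one_mul]
    refine add_le_add hfn ?_
    calc ∑ i, ‖Schauder.derivL i F‖ ≤ ∑ i : Fin n, (∑ j, ‖B‖ * C * ‖v j‖) * M :=
          Finset.sum_le_sum fun i _ => by
          rw [hFd, Finset.sum_mul]
          refine (norm_sum_le _ _).trans (Finset.sum_le_sum fun j _ => ?_)
          calc ‖B (P j) (Schauder.derivL i (v j))‖
              ≤ ‖B‖ * ‖P j‖ * ‖Schauder.derivL i (v j)‖ := B.le_opNorm₂ _ _
            _ ≤ ‖B‖ * (C * M) * ‖v j‖ := by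
              gcongr
              · exact hPn j
              · exact Schauder.norm_derivL_le i (v j)
            _ = ‖B‖ * C * ‖v j‖ * M := by ring
      _ = n * (∑ j, ‖B‖ * C * ‖v j‖) * M := by simp [mul_assoc]

end

/-! ### Taylor expansion of a function with factorial bounds on its derivatives -/

section

variable {n r : ℕ} {Ω : Opens (EuclideanSpace ℝ (Fin n))} {D : Opens (EuclideanSpace ℝ (Fin r))}
  {m : ℕ} {α : ℝ≥0}

/-- Taylor's formula with remainder on `[0, 1]`, for a function `g 0` with derivatives `g k`. -/
lemma abs_sub_taylor_le (N : ℕ) {g : ℕ → ℝ → ℝ} {M : ℝ}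
    (hg : ∀ k, ∀ t ∈ Set.Icc (0 : ℝ) 1, HasDerivAt (g k) (g (k + 1) t) t)
    (hM : ∀ t ∈ Set.Icc (0 : ℝ) 1, |g N t| ≤ M) :
    ∀ t ∈ Set.Icc (0 : ℝ) 1, |g 0 t - ∑ k ∈ Finset.range N, t ^ k / k.factorial * g k 0| ≤
      M * (t ^ N / N.factorial) := by
  induction N generalizing g with
  | zero => simpa using hM
  | succ N ih =>
    have hpow : ∀ (k : ℕ) (t : ℝ), HasDerivAt (fun t : ℝ => t ^ (k + 1) / (k + 1).factorial)
        (t ^ k / k.factorial) t := fun k t => by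
      refine ((hasDerivAt_pow (k + 1) t).div_const _).congr_deriv ?_
      rw [Nat.factorial_succ]
      push_cast
      field_simp
    have hd : ∀ t ∈ Set.Icc (0 : ℝ) 1, HasDerivAt
        (fun t => g 0 t - ∑ k ∈ Finset.range (N + 1), t ^ k / k.factorial * g k 0)
        (g 1 t - ∑ k ∈ Finset.range N, t ^ k / k.factorial * g (k + 1) 0) t := fun t ht => by
      refine (hg 0 t ht).sub ?_
      simp only [Finset.sum_range_succ' _ N, pow_zero]
      exact (HasDerivAt.fun_sum fun k (_ : k ∈ Finset.range N) =>
        (hpow k t).mul_const (g (k + 1) 0)).add_const _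
    intro t ht
    refine image_norm_le_of_norm_deriv_right_le_deriv_boundary
      (B := fun t => M * (t ^ (N + 1) / (N + 1).factorial)) (B' := fun t => M * (t ^ N / N.factorial))
      (fun s hs => (hd s hs).continuousAt.continuousWithinAt)
      (fun s hs => (hd s ⟨hs.1, hs.2.le⟩).hasDerivWithinAt) ?_
      (fun s => (hpow N s).const_mul M) (fun s hs => ?_) ht
    · simp [Finset.sum_range_succ']
    · exact ih (g := fun k => g (k + 1)) (fun k => hg (k + 1)) hM s ⟨hs.1, hs.2.le⟩

/-- The `N`-th differential of `U` at `y`, evaluated at `N` copies of `z`, as a sum over the words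
of length `N`. -/
def wordForm (U : EuclideanSpace ℝ (Fin r) → ℝ) (N : ℕ) (y z : EuclideanSpace ℝ (Fin r)) : ℝ :=
  ∑ j : Fin N → Fin r, wordD (List.ofFn j) U y * ∏ i, z (j i)

lemma wordForm_zero (U : EuclideanSpace ℝ (Fin r) → ℝ) (y z : EuclideanSpace ℝ (Fin r)) :
    wordForm U 0 y z = U y := by
  simp [wordForm]

lemma abs_wordForm_le {U : EuclideanSpace ℝ (Fin r) → ℝ} {N : ℕ} {y z : EuclideanSpace ℝ (Fin r)}
    {A c : ℝ} (hA : ∀ w : List (Fin r), w.length = N → |wordD w U y| ≤ A) (hc : ∀ i, |z i| ≤ c) :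
    |wordForm U N y z| ≤ A * (r * c) ^ N := by
  refine (Finset.abs_sum_le_sum_abs _ _).trans ?_
  calc _ ≤ ∑ j : Fin N → Fin r, A * c ^ N := Finset.sum_le_sum fun j _ => by
        have h := hA (List.ofFn j) (by simp)
        rw [abs_mul, Finset.abs_prod]
        refine mul_le_mul h ?_ (by positivity) ((abs_nonneg _).trans h)
        refine (Finset.prod_le_prod (fun _ _ => abs_nonneg _) fun i _ => hc (j i)).trans ?_
        simp
    _ = A * (r * c) ^ N := by
        simp
        ring

lemma hasDerivAt_wordForm {U : EuclideanSpace ℝ (Fin r) → ℝ} (hU : ContDiffOn ℝ (⊤ : ℕ∞) U D)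
    (N : ℕ) {y z : EuclideanSpace ℝ (Fin r)} {t : ℝ} (ht : y + t • z ∈ D) :
    HasDerivAt (fun t : ℝ => wordForm U N (y + t • z) z) (wordForm U (N + 1) (y + t • z) z) t := by
  have hl : HasDerivAt (fun t : ℝ => y + t • z) z t := by
    simpa using ((hasDerivAt_id t).smul_const z).const_add y
  have hw : ∀ w : List (Fin r), HasDerivAt (fun t : ℝ => wordD w U (y + t • z))
      (∑ i, wordD (i :: w) U (y + t • z) * z i) t := fun w => by
    have h1 : ContDiffOn ℝ (⊤ : ℕ∞) (wordD w U) D :=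
      contDiffOn_wordD D.isOpen hU w (by exact_mod_cast le_top)
    have h2 : HasFDerivAt (wordD w U) (fderiv ℝ (wordD w U) (y + t • z)) (y + t • z) :=
      ((h1.contDiffAt (D.isOpen.mem_nhds ht)).differentiableAt (by simp)).hasFDerivAt
    refine (h2.comp_hasDerivAt t hl).congr_deriv ?_
    rw [fderiv_eq_sum_pd]
    simp [wordD_cons]
  refine (HasDerivAt.fun_sum fun (j : Fin N → Fin r) (_ : j ∈ Finset.univ) =>
    (hw (List.ofFn j)).mul_const (∏ i, z (j i))).congr_deriv ?_
  rw [wordForm, ← (Fin.consEquiv fun _ : Fin (N + 1) => Fin r).sum_comp, Fintype.sum_prod_type,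
    Finset.sum_comm]
  refine Finset.sum_congr rfl fun j _ => ?_
  rw [Finset.sum_mul]
  refine Finset.sum_congr rfl fun i _ => ?_
  simp [Fin.consEquiv, List.ofFn_succ, Fin.prod_univ_succ]
  ring

/-- Convergence of the Taylor series, under the bounds that define the Roumieu class. -/
lemma tendsto_sum_wordForm {U : EuclideanSpace ℝ (Fin r) → ℝ} (hU : ContDiffOn ℝ (⊤ : ℕ∞) U D)
    {A q c : ℝ} (hq : 0 ≤ q) (hc0 : 0 ≤ c)
    (hA : ∀ w : List (Fin r), ∀ y ∈ D, |wordD w U y| ≤ A * (w.length.factorial * q ^ w.length))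
    {y z : EuclideanSpace ℝ (Fin r)} (hyz : ∀ t ∈ Set.Icc (0 : ℝ) 1, y + t • z ∈ D)
    (hc : ∀ i, |z i| ≤ c) (hlt : q * (r * c) < 1) :
    Filter.Tendsto (fun N => ∑ k ∈ Finset.range N, (k.factorial : ℝ)⁻¹ * wordForm U k y z)
      Filter.atTop (nhds (U (y + z))) := by
  have hrem : ∀ N, |U (y + z) - ∑ k ∈ Finset.range N, (k.factorial : ℝ)⁻¹ * wordForm U k y z| ≤
      A * (q * (r * c)) ^ N := fun N => by
    have h := abs_sub_taylor_le N (g := fun k t => wordForm U k (y + t • z) z)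
      (M := A * (N.factorial * q ^ N) * (r * c) ^ N)
      (fun k t ht => hasDerivAt_wordForm hU k (hyz t ht))
      (fun t ht => abs_wordForm_le (fun w hw => by
        rw [← hw]
        exact hA w _ (hyz t ht)) hc) 1 (by simp)
    simp only [wordForm_zero, one_smul, one_pow, zero_smul, add_zero, one_div] at h
    refine h.trans (le_of_eq ?_)
    rw [mul_pow q]
    field_simp
  rw [← tendsto_sub_nhds_zero_iff]
  refine squeeze_zero_norm (fun N => ?_) (show Filter.Tendsto (fun N => A * (q * (r * c)) ^ N)
    Filter.atTop (nhds 0) from ?_)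
  · rw [norm_sub_rev]
    exact hrem N
  · simpa using (tendsto_pow_atTop_nhds_zero_of_lt_one (by positivity) hlt).const_mul A

/-! ### Composition operators on the Roumieu class -/

namespace Roumieu

variable {ρ : {ρ : ℝ // 0 < ρ}}

lemma wordD_zeroExt (u : Roumieu ρ D) (w : List (Fin r)) {y : EuclideanSpace ℝ (Fin r)}
    (hy : y ∈ D) :
    wordD w (zeroExt u) y = closureDeriv (wordIdx w) u.toBCF ⟨y, subset_closure hy⟩ := by
  have hu : ContDiffOn ℝ (⊤ : ℕ∞) (zeroExt u) D := u.mem.1.1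
  rw [isClosureDeriv_closureDeriv u.mem.1 (wordIdx w) le_top _ hy,
    ← partialD_wordIdx D.isOpen (hu.of_le (by exact_mod_cast le_top)) hy]
  rfl

lemma abs_wordD_le (u : Roumieu ρ D) (w : List (Fin r)) {y : EuclideanSpace ℝ (Fin r)}
    (hy : y ∈ D) :
    |wordD w (zeroExt u) y| ≤ ‖u‖ * (w.length.factorial * (ρ : ℝ)⁻¹ ^ w.length) := by
  rw [wordD_zeroExt u w hy]
  refine ((closureDeriv (wordIdx w) u.toBCF).norm_coe_le_norm _).trans ?_
  have h := u.roumieuTerm_le_norm (wordIdx w)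
  have hρ : (0 : ℝ) < ρ := ρ.2
  rw [roumieuTerm, sum_wordIdx] at h
  rw [inv_pow]
  field_simp at h ⊢
  linarith

/-- The operators `u ↦ (D_w u) ∘ v`, for the words `w`. The factorials in the bound of their norms
are the ones of the Roumieu class; that `m + 1` more derivatives of `u` are taken is absorbed by
the geometric factor. -/
lemma exists_compL (hb : Bornology.IsBounded (Ω : Set (EuclideanSpace ℝ (Fin n))))
    (hΩ : IsOfClass 1 (Ω : Set (EuclideanSpace ℝ (Fin n)))) (hα : α ≤ 1)
    (ρ : {ρ : ℝ // 0 < ρ}) {v : Fin r → Schauder m α Ω}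
    (hv : v ∈ schauderInto m α Ω (D : Set (EuclideanSpace ℝ (Fin r)))) :
    ∃ C q : ℝ, 0 ≤ C ∧ 0 ≤ q ∧ ∀ w : List (Fin r), ∃ K : Roumieu ρ D →L[ℝ] Schauder m α Ω,
      (∀ u x, K u x = wordD w (zeroExt u) (Schauder.eval v x)) ∧
      ‖K‖ ≤ C * (w.length.factorial * q ^ w.length) := by
  obtain ⟨C, hC, H⟩ := exists_comp hb hΩ hα m v hv
  set R : ℝ := max 1 (ρ : ℝ)⁻¹ with hR
  have hR1 : 1 ≤ R := le_max_left _ _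
  have hρ : (0 : ℝ) ≤ (ρ : ℝ)⁻¹ := inv_nonneg.2 ρ.2.le
  refine ⟨C * ((m + 1).factorial * (2 * R) ^ (m + 1)), 2 * R, by positivity, by positivity,
    fun w => ?_⟩
  have hcd : ∀ u : Roumieu ρ D, ContDiffOn ℝ (⊤ : ℕ∞) (wordD w (zeroExt u)) D := fun u =>
    contDiffOn_wordD D.isOpen u.mem.1.1 w (by exact_mod_cast le_top)
  have hbd : ∀ (u : Roumieu ρ D) (w' : List (Fin r)), w'.length ≤ m + 1 → ∀ y ∈ D,
      |wordD w' (wordD w (zeroExt u)) y| ≤ ‖u‖ * ((m + 1).factorial * (2 * R) ^ (m + 1) *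
        (w.length.factorial * (2 * R) ^ w.length)) := fun u w' hw' y hy => by
    rw [← wordD_append]
    refine (abs_wordD_le u (w' ++ w) hy).trans ?_
    refine mul_le_mul_of_nonneg_left ?_ (norm_nonneg u)
    rw [List.length_append]
    have h1 : ((w'.length + w.length).factorial : ℝ) ≤
        2 ^ (m + 1 + w.length) * ((m + 1).factorial * w.length.factorial) := by
      rw [← Nat.add_choose_mul_factorial_mul_factorial]
      have h2 : (w'.length + w.length).choose w.length ≤ 2 ^ (m + 1 + w.length) :=
        (Nat.choose_le_two_pow _ _).trans (Nat.pow_le_pow_right two_pos (by omega))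
      have h3 : w'.length.factorial ≤ (m + 1).factorial := Nat.factorial_le hw'
      rw [mul_assoc]
      exact_mod_cast Nat.mul_le_mul h2 (Nat.mul_le_mul_right _ h3)
    have h4 : (ρ : ℝ)⁻¹ ^ (w'.length + w.length) ≤ R ^ (m + 1 + w.length) :=
      (pow_le_pow_left₀ hρ (le_max_right _ _) _).trans (pow_le_pow_right₀ hR1 (by omega))
    refine (mul_le_mul h1 h4 (by positivity) (by positivity)).trans (le_of_eq ?_)
    rw [mul_pow, mul_pow, pow_add, pow_add]
    ring
  choose F hF hFn using fun u : Roumieu ρ D => H (wordD w (zeroExt u)) _ (by positivity) (hcd u)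
    (hbd u)
  refine ⟨LinearMap.mkContinuous { toFun := F, map_add' := fun u u' => ?_, map_smul' := fun c u => ?_ }
    (C * ((m + 1).factorial * (2 * R) ^ (m + 1)) * (w.length.factorial * (2 * R) ^ w.length))
    fun u => (hFn u).trans (le_of_eq (by ring)), hF, LinearMap.mkContinuous_norm_le _ (by positivity) _⟩
  · refine Schauder.ext fun x => ?_
    rw [Schauder.add_apply, hF, hF, hF, wordD_zeroExt _ _ (hv x), wordD_zeroExt _ _ (hv x),
      wordD_zeroExt _ _ (hv x)]
    exact DFunLike.congr_fun (closureDeriv_add u.mem.1 u'.mem.1 _ le_top) _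
  · refine Schauder.ext fun x => ?_
    rw [RingHom.id_apply, Schauder.smul_apply, hF, hF, wordD_zeroExt _ _ (hv x),
      wordD_zeroExt _ _ (hv x)]
    exact DFunLike.congr_fun (closureDeriv_smul c u.mem.1 _ le_top) _

end Roumieu

end

/-! ### The power series of the composition operator -/

section

variable {n r : ℕ} {Ω : Opens (EuclideanSpace ℝ (Fin n))} {D : Opens (EuclideanSpace ℝ (Fin r))}
  {m : ℕ} {α : ℝ≥0} {ρ : {ρ : ℝ // 0 < ρ}}

namespace Schauder

/-- The point evaluation at `x`. -/
def evalL (x : closure (Ω : Set (EuclideanSpace ℝ (Fin n)))) : Schauder m α Ω →L[ℝ] ℝ :=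
  LinearMap.mkContinuous
    { toFun := fun f => f x
      map_add' := fun _ _ => rfl
      map_smul' := fun _ _ => rfl } 1 fun f => (norm_apply_le f x).trans (one_mul _).ge

lemma evalL_apply (x : closure (Ω : Set (EuclideanSpace ℝ (Fin n)))) (f : Schauder m α Ω) :
    evalL x f = f x := rfl

/-- A product of multiplication operators is the multiplication by the product of the values. -/
lemma list_prod_apply {B : Schauder m α Ω →L[ℝ] Schauder m α Ω →L[ℝ] Schauder m α Ω}
    (hB : ∀ f g x, B f g x = f x * g x) (l : List (Schauder m α Ω)) (f : Schauder m α Ω) (x) :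
    (l.map B).prod f x = (l.map fun g => g x).prod * f x := by
  induction l with
  | nil => simp
  | cons g l ih =>
    rw [List.map_cons, List.prod_cons, List.map_cons, List.prod_cons, mul_assoc, ← ih]
    exact hB g _ x

end Schauder

/-- The power series at `v` of `w ↦ (u ↦ u ∘ w)`, where `K w` is the operator `u ↦ (D_w u) ∘ v` and
`B` the multiplication of the Schauder space. Its `N`-th term sends `(w₁, …, w_N)` to
`u ↦ (1/N!) ∑_{j₁, …, j_N} w_{1,j₁} ⋯ w_{N,j_N} (∂_{j₁} ⋯ ∂_{j_N} u) ∘ v`. -/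
def compSeries (B : Schauder m α Ω →L[ℝ] Schauder m α Ω →L[ℝ] Schauder m α Ω)
    (K : List (Fin r) → Roumieu ρ D →L[ℝ] Schauder m α Ω) :
    FormalMultilinearSeries ℝ (Fin r → Schauder m α Ω) (Roumieu ρ D →L[ℝ] Schauder m α Ω) :=
  fun N => ∑ j : Fin N → Fin r,
    ((ContinuousLinearMap.compL ℝ (Roumieu ρ D) (Schauder m α Ω) (Schauder m α Ω)).flip
      ((N.factorial : ℝ)⁻¹ • K (List.ofFn j))).compContinuousMultilinearMap
    ((ContinuousMultilinearMap.mkPiAlgebraFin ℝ N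
      (Schauder m α Ω →L[ℝ] Schauder m α Ω)).compContinuousLinearMap
      fun i => B.comp (ContinuousLinearMap.proj (R := ℝ) (j i)))

lemma norm_compSeries_le (B : Schauder m α Ω →L[ℝ] Schauder m α Ω →L[ℝ] Schauder m α Ω)
    {K : List (Fin r) → Roumieu ρ D →L[ℝ] Schauder m α Ω} {C q : ℝ} (hC : 0 ≤ C) (hq : 0 ≤ q)
    (hK : ∀ w, ‖K w‖ ≤ C * (w.length.factorial * q ^ w.length)) (N : ℕ) :
    ‖compSeries B K N‖ ≤ C * (r * q * ‖B‖) ^ N := by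
  have hterm : ∀ j : Fin N → Fin r,
      ‖((ContinuousLinearMap.compL ℝ (Roumieu ρ D) (Schauder m α Ω) (Schauder m α Ω)).flip
      ((N.factorial : ℝ)⁻¹ • K (List.ofFn j))).compContinuousMultilinearMap
      ((ContinuousMultilinearMap.mkPiAlgebraFin ℝ N
      (Schauder m α Ω →L[ℝ] Schauder m α Ω)).compContinuousLinearMap
      fun i => B.comp (ContinuousLinearMap.proj (R := ℝ) (φ := fun _ => Schauder m α Ω) (j i)))‖ ≤
      C * q ^ N * ‖B‖ ^ N := fun j => by
    refine (ContinuousLinearMap.norm_compContinuousMultilinearMap_le _ _).trans ?_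
    have h1 : ‖(ContinuousLinearMap.compL ℝ (Roumieu ρ D) (Schauder m α Ω) (Schauder m α Ω)).flip
        ((N.factorial : ℝ)⁻¹ • K (List.ofFn j))‖ ≤ C * q ^ N := by
      have h : ‖(N.factorial : ℝ)⁻¹ • K (List.ofFn j)‖ ≤ C * q ^ N := by
        have h' := hK (List.ofFn j)
        rw [List.length_ofFn] at h'
        rw [norm_smul, norm_inv, RCLike.norm_natCast, inv_mul_le_iff₀ (by positivity)]
        exact h'.trans (le_of_eq (by ring))
      refine le_trans (ContinuousLinearMap.opNorm_le_bound _ (norm_nonneg _) fun A => ?_) h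
      rw [ContinuousLinearMap.flip_apply, ContinuousLinearMap.compL_apply, mul_comm]
      exact ContinuousLinearMap.opNorm_comp_le _ _
    have h2 : ‖(ContinuousMultilinearMap.mkPiAlgebraFin ℝ N
      (Schauder m α Ω →L[ℝ] Schauder m α Ω)).compContinuousLinearMap
      fun i => B.comp (ContinuousLinearMap.proj (R := ℝ) (φ := fun _ => Schauder m α Ω) (j i))‖ ≤
        ‖B‖ ^ N := by
      refine (ContinuousMultilinearMap.norm_compContinuousLinearMap_le _ _).trans ?_
      have h3 : ‖ContinuousMultilinearMap.mkPiAlgebraFin ℝ N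
          (Schauder m α Ω →L[ℝ] Schauder m α Ω)‖ ≤ 1 :=
        ContinuousMultilinearMap.norm_mkPiAlgebraFin_le.trans
          (max_le le_rfl ContinuousLinearMap.norm_id_le)
      refine (mul_le_of_le_one_left (by positivity) h3).trans ?_
      rw [← Fin.prod_const]
      refine Finset.prod_le_prod (fun _ _ => norm_nonneg _) fun i _ => ?_
      refine (ContinuousLinearMap.opNorm_comp_le _ _).trans
        (mul_le_of_le_one_right (norm_nonneg _) ?_)
      refine ContinuousLinearMap.opNorm_le_bound _ zero_le_one fun f => ?_
      rw [one_mul]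
      exact norm_le_pi_norm (show Fin r → Schauder m α Ω from f) (j i)
    exact mul_le_mul h1 h2 (norm_nonneg _) (by positivity)
  refine (norm_sum_le _ _).trans ((Finset.sum_le_sum fun j _ => hterm j).trans (le_of_eq ?_))
  simp only [Finset.sum_const, Finset.card_univ, Fintype.card_pi_const, Fintype.card_fin,
    nsmul_eq_mul, Nat.cast_pow, mul_pow]
  ring

lemma compSeries_apply {B : Schauder m α Ω →L[ℝ] Schauder m α Ω →L[ℝ] Schauder m α Ω}
    (hB : ∀ f g x, B f g x = f x * g x) {K : List (Fin r) → Roumieu ρ D →L[ℝ] Schauder m α Ω}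
    {v : Fin r → Schauder m α Ω}
    (hK : ∀ w u x, K w u x = wordD w (zeroExt u) (Schauder.eval v x))
    (N : ℕ) (w : Fin r → Schauder m α Ω) (u : Roumieu ρ D) (x) :
    compSeries B K N (fun _ => w) u x = (N.factorial : ℝ)⁻¹ *
      wordForm (zeroExt u) N (Schauder.eval v x) (Schauder.eval w x) := by
  have hterm : ∀ j : Fin N → Fin r, (List.ofFn fun i => B (w (j i))).prod (K (List.ofFn j) u) x =
      wordD (List.ofFn j) (zeroExt u) (Schauder.eval v x) *
        ∏ i, Schauder.eval w x (j i) := fun j => by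
    have h := Schauder.list_prod_apply hB (List.ofFn fun i => w (j i)) (K (List.ofFn j) u) x
    rw [List.map_ofFn, List.map_ofFn, hK, mul_comm,
      List.prod_ofFn (f := (fun g : Schauder m α Ω => g x) ∘ fun i => w (j i))] at h
    exact h
  rw [← Schauder.evalL_apply, compSeries]
  simp only [sum_apply, map_sum, wordForm, Finset.mul_sum]
  refine Finset.sum_congr rfl fun j _ => ?_
  rw [← hterm j, ← Schauder.evalL_apply, ← smul_eq_mul, ← map_smul, ← map_smul]
  rfl

/-- `v ↦ (u ↦ u ∘ v)` is analytic, as an operator-valued map, at the points of `C^{m,α}(cl Ω, D)`;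
its values off this open set are irrelevant. -/
lemma analyticAt_comp (hb : Bornology.IsBounded (Ω : Set (EuclideanSpace ℝ (Fin n))))
    (hΩ : IsOfClass 1 (Ω : Set (EuclideanSpace ℝ (Fin n)))) (hα : α ≤ 1)
    {S : (Fin r → Schauder m α Ω) → Roumieu ρ D →L[ℝ] Schauder m α Ω}
    (hS : ∀ v ∈ schauderInto m α Ω (D : Set (EuclideanSpace ℝ (Fin r))), ∀ u x,
      S v u x = zeroExt u (Schauder.eval v x))
    {v : Fin r → Schauder m α Ω} (hv : v ∈ schauderInto m α Ω (D : Set (EuclideanSpace ℝ (Fin r)))) :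
    AnalyticAt ℝ S v := by
  obtain ⟨B, hB⟩ := Schauder.exists_mulL hb hΩ hα m
  obtain ⟨C, q, hC, hq, H⟩ := Roumieu.exists_compL hb hΩ hα ρ hv
  choose K hK hKn using H
  obtain ⟨δ, hδ, hball⟩ := exists_ball_subset hb hv
  set ρ' : ℝ := (ρ : ℝ)⁻¹ with hρ'
  have hρ0 : 0 ≤ ρ' := inv_nonneg.2 ρ.2.le
  -- the radius is the inverse of `Q`; the summands of `Q` ensure, in this order, that the power
  -- series converges, that the segments from `v(x)` to `(v + w)(x)` stay in `D`, and that the Taylor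
  -- series of `u` at the points `v(x)` converge
  set Q : ℝ := r * q * ‖B‖ + r / δ + r * ρ' + 1 with hQ
  have hQ0 : 0 < Q := by positivity
  set p := compSeries B K with hp
  set R : ℝ≥0 := ⟨Q⁻¹, by positivity⟩ with hR
  have hR0 : 0 < R := NNReal.coe_pos.1 (inv_pos.2 hQ0)
  have hrad : (R : ENNReal) ≤ p.radius := by
    refine p.le_radius_of_bound C fun N => ?_
    refine (mul_le_mul_of_nonneg_right (norm_compSeries_le B hC hq hKn N) (by positivity)).trans ?_
    rw [mul_assoc, ← mul_pow]
    refine mul_le_of_le_one_right hC (pow_le_one₀ (by positivity) ?_)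
    change r * q * ‖B‖ * Q⁻¹ ≤ 1
    rw [← div_eq_mul_inv, div_le_one hQ0, hQ]
    have : 0 ≤ r / δ + r * ρ' := by positivity
    linarith
  refine ⟨p, R, hrad, by exact_mod_cast hR0, fun {w} hw => ?_⟩
  have hsum := p.hasSum (Metric.eball_subset_eball hrad hw)
  convert hsum using 1
  have hwQ : ‖w‖ * Q < 1 := by
    have : ‖w‖ < Q⁻¹ := by
      rw [Metric.mem_eball, edist_zero_right, ← ofReal_norm,
        ← ENNReal.ofReal_coe_nnreal] at hw
      exact (ENNReal.ofReal_lt_ofReal_iff hR0).1 hw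
    rwa [inv_eq_one_div, lt_div_iff₀ hQ0] at this
  have hw1 : r * ‖w‖ < δ := by
    rw [← div_lt_one hδ, mul_comm, mul_div_assoc]
    refine lt_of_le_of_lt (mul_le_mul_of_nonneg_left ?_ (norm_nonneg w)) hwQ
    have : 0 ≤ r * q * ‖B‖ + r * ρ' := by positivity
    linarith
  have hw2 : ρ' * (r * ‖w‖) < 1 := by
    have e : ρ' * (r * ‖w‖) = ‖w‖ * (r * ρ') := by ring
    rw [e]
    refine lt_of_le_of_lt (mul_le_mul_of_nonneg_left ?_ (norm_nonneg w)) hwQ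
    have : 0 ≤ r * q * ‖B‖ + r / δ := by positivity
    linarith
  have hseg : ∀ x, ∀ t ∈ Set.Icc (0 : ℝ) 1, Schauder.eval v x + t • Schauder.eval w x ∈ D :=
    fun x t ht => hball x (by
      rw [mem_ball_iff_norm, add_sub_cancel_left, norm_smul, Real.norm_of_nonneg ht.1]
      exact (mul_le_of_le_one_left (norm_nonneg _) ht.2).trans_lt
        ((Schauder.norm_eval_le w x).trans_lt hw1))
  have hvw : v + w ∈ schauderInto m α Ω (D : Set (EuclideanSpace ℝ (Fin r))) := fun x => by
    simpa [Schauder.eval_add] using hseg x 1 (by simp)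
  refine ContinuousLinearMap.ext fun u => Schauder.ext fun x => ?_
  rw [hS _ hvw, Schauder.eval_add]
  refine tendsto_nhds_unique (tendsto_sum_wordForm (D := D) u.mem.1.1 hρ0 (norm_nonneg w)
    (fun w y hy => Roumieu.abs_wordD_le u w hy) (hseg x)
    (fun i => (Schauder.norm_apply_le (w i) x).trans (norm_le_pi_norm w i)) hw2) ?_
  have hL := (((Schauder.evalL x).comp (ContinuousLinearMap.apply ℝ (Schauder m α Ω) u)).hasSum
    hsum).tendsto_sum_nat
  refine Filter.Tendsto.congr (fun N => Finset.sum_congr rfl fun k _ => ?_)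
    (show Filter.Tendsto _ _ (nhds (p.sum w u x)) from hL)
  exact compSeries_apply hB hK k w u x

end

end SchauderRoumieu

end

/-- The composition operator `T[u,v] = u ∘ v` is defined on the open set
`C⁰_{ω,ρ}(cl Ω) × C^{m,α}(cl Ω', Ω)`, takes values in `C^{m,α}(cl Ω')` and is real analytic. -/
theorem propositionA1 (m h k : ℕ) (hh : 1 ≤ h) (hk : 1 ≤ k)
    (α : ℝ≥0) (hα₀ : 0 < α) (hα₁ : α ≤ 1) (ρ : {ρ : ℝ // 0 < ρ})
    (Ω : Opens (EuclideanSpace ℝ (Fin h))) (Ω' : Opens (EuclideanSpace ℝ (Fin k)))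
    (hΩb : Bornology.IsBounded (Ω : Set (EuclideanSpace ℝ (Fin h))))
    (hΩc : IsConnected (Ω : Set (EuclideanSpace ℝ (Fin h))))
    (hΩ'b : Bornology.IsBounded (Ω' : Set (EuclideanSpace ℝ (Fin k))))
    (hΩ'c : IsConnected (Ω' : Set (EuclideanSpace ℝ (Fin k))))
    (hΩ' : IsOfClass 1 (Ω' : Set (EuclideanSpace ℝ (Fin k)))) :
    IsOpen ((Set.univ : Set (Roumieu ρ Ω)) ×ˢ
      schauderInto m α Ω' (Ω : Set (EuclideanSpace ℝ (Fin h)))) ∧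
    ∃ T : Roumieu ρ Ω × (Fin h → Schauder m α Ω') → Schauder m α Ω',
      (∀ (u : Roumieu ρ Ω) (v : Fin h → Schauder m α Ω')
        (hv : v ∈ schauderInto m α Ω' (Ω : Set (EuclideanSpace ℝ (Fin h))))
        (x : closure (Ω' : Set (EuclideanSpace ℝ (Fin k)))),
        T (u, v) x = u ⟨Schauder.eval v x, subset_closure (hv x)⟩) ∧
      AnalyticOnNhd ℝ T ((Set.univ : Set (Roumieu ρ Ω)) ×ˢ
        schauderInto m α Ω' (Ω : Set (EuclideanSpace ℝ (Fin h)))) := by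
  classical
  have hex : ∀ v : Fin h → Schauder m α Ω', ∃ S : Roumieu ρ Ω →L[ℝ] Schauder m α Ω',
      v ∈ schauderInto m α Ω' (Ω : Set (EuclideanSpace ℝ (Fin h))) →
        ∀ u x, S u x = zeroExt u (Schauder.eval v x) := fun v => by
    by_cases hv : v ∈ schauderInto m α Ω' (Ω : Set (EuclideanSpace ℝ (Fin h)))
    · obtain ⟨_, _, _, _, H⟩ := Roumieu.exists_compL hΩ'b hΩ' hα₁ ρ hv
      obtain ⟨K, hK, _⟩ := H []
      exact ⟨K, fun _ => hK⟩
    · exact ⟨0, fun hv' => absurd hv' hv⟩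
  choose S hS using hex
  refine ⟨isOpen_univ.prod (isOpen_schauderInto hΩ'b), fun p => S p.2 p.1, fun u v hv x => ?_, ?_⟩
  · rw [hS v hv, zeroExt_of_mem _ (hv x)]
  · rintro ⟨u, v⟩ ⟨-, hv⟩
    have hSv : AnalyticAt ℝ S v := analyticAt_comp hΩ'b hΩ' hα₁ hS hv
    -- `T[u,v] = S(v) u`, and the pairing of operators and vectors is bilinear
    exact ((ContinuousLinearMap.id ℝ (Roumieu ρ Ω →L[ℝ] Schauder m α Ω')).analyticAt_bilinear
      (S v, u)).comp_of_eq ((hSv.comp_of_eq analyticAt_snd rfl).prod analyticAt_fst) rfl
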